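/- Let $0<\kappa<1$. On the Hilbert space of a single bosonic mode with Fock basis $(|n\rangle)_{n\ge 0}$ put $$B_\ell(\kappa)=\sum_{m=0}^{\infty}\sqrt{\tbinom{m+\ell}{\ell}}\,\bigl(\sqrt{1-\kappa^2}\bigr)^{\ell}\kappa^{m}\,|m\rangle\langle m+\ell|,\qquad \ell=0,1,2,\dots$$ For $\alpha,\xi\in\mathbb C$ let $|\alpha\rangle=e^{-|\alpha|^2/2}\sum_n \frac{\alpha^n}{\sqrt{n!}}|n\rangle$ be the coherent state and $D(\xi)=e^{\xi a^\dagger-\xi^* a}$ the Weyl displacement operator. For a trace-class operator $T$ let $\chi_W^T(\xi)=\mathrm{Tr}(T D(\xi))$ and $\chi_N^T(\xi)=\chi_W^T(\xi)\,e^{|\xi|^2/2}$ be its Weyl-ordered and normally ordered characteristic functions, and let its (Sudarshan) diagonal weight be the generalized function $\phi_T(\alpha)=\pi^{-1}\int \chi_N^T(\xi)\,e^{\alpha\xi^*-\alpha^*\xi}\,d^2\xi$, defined by pairing with the Schwartz functions on $\mathbb C$ whose Fourier transform has compact support; formally $T=\pi^{-1}\int\phi_T(\alpha)\,|\alpha\rangle\langle\alpha|\,d^2\alpha$.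 There is a linear map $\Phi$ on the trace class with the following properties. 1. $\Phi$ is the scaling of the diagonal weight $\phi(\alpha)\mapsto\kappa^{-2}\phi(\kappa^{-1}\alpha)$: for all trace-class $T,S$, one has $\phi_S(\alpha)=\kappa^{-2}\phi_T(\kappa^{-1}\alpha)$ if and only if $S=\Phi(T)$. 2. $\Phi$ is completely positive and trace preserving, and has the Kraus decomposition $\Phi(T)=\sum_{\ell} B_\ell(\kappa)\,T\,B_\ell(\kappa)^\dagger$ (convergent in operator norm), with $\sum_\ell B_\ell(\kappa)^\dagger B_\ell(\kappa)=1$ (strongly). 3. $\Phi$ is the quantum-limited attenuator $\mathcal C_1(\kappa)$: $\chi_W^{\Phi(T)}(\xi)=\chi_W^{T}(\kappa\xi)\,e^{-(1-\kappa^2)|\xi|^2/2}$ for every trace-class $T$ and every $\xi\in\mathbb C$. 4. $\Phi(|\alpha\rangle\langle\alpha|)=|\kappa\alpha\rangle\langle\kappa\alpha|$ for every $\alpha\in\mathbb C$. 5. If $T=\pi^{-1}\int\phi(\alpha)\,|\alpha\rangle\langle\alpha|\,d^2\alpha$ for an ordinary function $\phi:\mathbb C\to\mathbb C$ (weakly,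 that is, for all matrix elements, with absolutely convergent integrals), then $\Phi(T)=\pi^{-1}\int\kappa^{-2}\phi(\kappa^{-1}\alpha)\,|\alpha\rangle\langle\alpha|\,d^2\alpha$ in the same sense. 6. Nonclassicality is neither created nor destroyed: for every density operator $\rho$, $\Phi(\rho)$ is a density operator, and $\Phi(\rho)$ is classical if and only if $\rho$ is classical, where $\rho$ is called classical if $\phi_\rho$ is nonnegative, i.e. is given by a finite nonnegative measure on $\mathbb C$. -/

import Mathlib

open scoped InnerProductSpace ComplexConjugate ComplexOrder SchwartzMap
open MeasureTheory

noncomputable section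

/-! ### The Hilbert space of a single bosonic mode -/

/-- The Hilbert space of a single mode: square-summable sequences of Fock-basis amplitudes. -/
abbrev Fock : Type := lp (fun _ : ℕ => ℂ) 2

/-- Bounded operators on the mode. -/
abbrev Op : Type := Fock →L[ℂ] Fock

/-- The Fock state `|n⟩`. -/
def fock (n : ℕ) : Fock := lp.single 2 n (1 : ℂ)

/-- The trace `∑ₙ ⟨n|A|n⟩`, computed in the Fock basis. -/
def opTrace (A : Op) : ℂ := ∑' n, ⟪fock n, A (fock n)⟫_ℂ

/-- The trace class: the linear span of the positive operators of finite trace. -/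
def TraceClass : Submodule ℂ Op :=
  Submodule.span ℂ {A | A.IsPositive ∧ Summable fun n => ⟪fock n, A (fock n)⟫_ℂ}

/-- A state (density operator): a positive trace-class operator of unit trace. -/
def IsState (T : TraceClass) : Prop :=
  (T : Op).IsPositive ∧ opTrace T = 1

/-! ### Coherent states -/

/-- Fock amplitudes `exp(-|α|²/2) αⁿ / √n!` of the coherent state `|α⟩`. -/
def coherentCoeff (α : ℂ) (n : ℕ) : ℂ :=
  (Real.exp (-‖α‖ ^ 2 / 2) : ℂ) * (α ^ n / (Real.sqrt n.factorial : ℂ))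

theorem norm_coherentCoeff_sq (α : ℂ) (n : ℕ) :
    ‖coherentCoeff α n‖ ^ 2 =
      Real.exp (-‖α‖ ^ 2 / 2) ^ 2 * ((‖α‖ ^ 2) ^ n / n.factorial) := by
  unfold coherentCoeff
  rw [norm_mul, norm_div, norm_pow, Complex.norm_real, Complex.norm_real, mul_pow, div_pow,
    Real.norm_eq_abs, Real.norm_eq_abs, sq_abs, sq_abs, Real.sq_sqrt (by positivity)]
  ring

theorem summable_coherentCoeff (α : ℂ) : Summable fun n => ‖coherentCoeff α n‖ ^ 2 := by
  simp_rw [norm_coherentCoeff_sq]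
  exact (Real.summable_pow_div_factorial _).mul_left _

/-- The coherent state `|α⟩`. -/
def coherent (α : ℂ) : Fock :=
  ⟨coherentCoeff α, memℓp_gen (by simpa using summable_coherentCoeff α)⟩

theorem coherent_apply (α : ℂ) (n : ℕ) : (coherent α : ℕ → ℂ) n = coherentCoeff α n := rfl

/-- The projector `|α⟩⟨α|` onto a coherent state, as a trace-class operator. -/
def coherentProj (α : ℂ) : TraceClass :=
  ⟨InnerProductSpace.rankOne ℂ (coherent α) (coherent α), by
    refine Submodule.subset_span ⟨InnerProductSpace.isPositive_rankOne_self _, ?_⟩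
    have h : Summable fun n => ((‖coherentCoeff α n‖ ^ 2 : ℝ) : ℂ) :=
      Complex.ofRealCLM.summable (summable_coherentCoeff α)
    refine h.congr fun n => ?_
    rw [InnerProductSpace.rankOne_apply, inner_smul_right, fock, lp.inner_single_left,
      lp.inner_single_right, coherent_apply]
    simp [← Complex.mul_conj', mul_comm]⟩

theorem inner_coherent (α β : ℂ) :
    ⟪coherent α, coherent β⟫_ℂ =
      Complex.exp (-(‖α‖ : ℂ) ^ 2 / 2 - (‖β‖ : ℂ) ^ 2 / 2 + conj α * β) := by
  have he : ∀ z : ℂ, Complex.exp z = ∑' n : ℕ, z ^ n / (n.factorial : ℂ) := fun z => by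
    rw [Complex.exp_eq_exp_ℂ, NormedSpace.exp_eq_tsum_div]
  rw [lp.inner_eq_tsum, Complex.exp_add, he (conj α * β), ← tsum_mul_left]
  refine tsum_congr fun n => ?_
  rw [coherent_apply, coherent_apply, RCLike.inner_apply, coherentCoeff, coherentCoeff,
    sub_eq_add_neg, Complex.exp_add]
  have hs : ((Real.sqrt n.factorial : ℝ) : ℂ) * ((Real.sqrt n.factorial : ℝ) : ℂ)
      = (n.factorial : ℂ) := by
    rw [← Complex.ofReal_mul, Real.mul_self_sqrt (by positivity)]; simp
  simp only [map_mul, map_div₀, map_pow, Complex.conj_ofReal]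
  rw [← hs]
  push_cast
  rw [neg_div]
  ring

/-! ### Displacement operators -/

/-- Finite linear combinations of coherent states. -/
def coherentSpan : (ℂ →₀ ℂ) →ₗ[ℂ] Fock := Finsupp.linearCombination ℂ coherent

/-- The action of the Weyl displacement `exp(ξ a† - ξ* a)` on finite linear combinations of
coherent states, determined by `|α⟩ ↦ exp((ξ α* - ξ* α)/2) |α + ξ⟩`. -/
def displacedSpan (ξ : ℂ) : (ℂ →₀ ℂ) →ₗ[ℂ] Fock :=
  Finsupp.linearCombination ℂ fun α =>
    Complex.exp ((ξ * conj α - conj ξ * α) / 2) • coherent (α + ξ)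

/-- The Weyl displacement operator `D(ξ) = exp(ξ a† - ξ* a)`: the bounded operator on the whole
space that is determined by its action on coherent states (see `displacement_coherent` and
`displacement_unique`). -/
def displacement (ξ : ℂ) : Op := (displacedSpan ξ).extendOfNorm coherentSpan

theorem inner_displaced (ξ α β : ℂ) :
    ⟪Complex.exp ((ξ * conj α - conj ξ * α) / 2) • coherent (α + ξ),
      Complex.exp ((ξ * conj β - conj ξ * β) / 2) • coherent (β + ξ)⟫_ℂ =
      ⟪coherent α, coherent β⟫_ℂ := by
  rw [inner_smul_left, inner_smul_right, inner_coherent, inner_coherent, ← Complex.exp_conj,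
    ← Complex.exp_add, ← Complex.exp_add]
  congr 1
  simp only [← Complex.conj_mul', map_add, map_sub, map_mul, map_div₀, Complex.conj_conj,
    map_ofNat]
  ring

theorem norm_displacedSpan (ξ : ℂ) (f : ℂ →₀ ℂ) : ‖displacedSpan ξ f‖ = ‖coherentSpan f‖ := by
  have h : ⟪displacedSpan ξ f, displacedSpan ξ f⟫_ℂ = ⟪coherentSpan f, coherentSpan f⟫_ℂ := by
    simp only [displacedSpan, coherentSpan, Finsupp.linearCombination_apply, Finsupp.sum,
      sum_inner, inner_sum]
    refine Finset.sum_congr rfl fun α _ => Finset.sum_congr rfl fun β _ => ?_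
    rw [inner_smul_left, inner_smul_right, inner_displaced, inner_smul_left, inner_smul_right]
  rw [@norm_eq_sqrt_re_inner ℂ, @norm_eq_sqrt_re_inner ℂ, h]

theorem eq_zero_of_inner_coherent (v : Fock) (h : ∀ α, ⟪v, coherent α⟫_ℂ = 0) : v = 0 := by
  set c : ℕ → ℂ := fun n => conj ((v : ℕ → ℂ) n) / (Real.sqrt n.factorial : ℂ) with hc
  have hs : ∀ α : ℂ, HasSum (fun n => α ^ n • c n) 0 := by
    intro α
    have h1 := lp.hasSum_inner (𝕜 := ℂ) v (coherent α)
    rw [h α] at h1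
    have hne : (Real.exp (-‖α‖ ^ 2 / 2) : ℂ) ≠ 0 := by
      exact_mod_cast (Real.exp_pos _).ne'
    have h2 := h1.mul_left ((Real.exp (-‖α‖ ^ 2 / 2) : ℂ))⁻¹
    rw [mul_zero] at h2
    refine h2.congr_fun ?_
    intro n
    rw [coherent_apply, RCLike.inner_apply, coherentCoeff]
    simp only [hc, smul_eq_mul]
    field_simp
  have hp : HasFPowerSeriesAt (0 : ℂ → ℂ) (FormalMultilinearSeries.ofScalars ℂ c) 0 := by
    rw [hasFPowerSeriesAt_iff]
    refine Filter.Eventually.of_forall fun z => ?_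
    simpa [FormalMultilinearSeries.coeff_ofScalars] using hs z
  have h0 := hp.eq_zero
  ext n
  have h1 : c n = 0 := by
    have := congrFun ((FormalMultilinearSeries.ofScalars_series_eq_zero (E := ℂ)).1 h0) n
    simpa using this
  have h2 : (Real.sqrt n.factorial : ℂ) ≠ 0 := by
    have : (0 : ℝ) < Real.sqrt n.factorial := Real.sqrt_pos.2 (by positivity)
    exact_mod_cast this.ne'
  simpa [hc, h2] using h1

theorem denseRange_coherentSpan : DenseRange coherentSpan := by
  have h : (LinearMap.range coherentSpan).topologicalClosure = ⊤ := by
    rw [Submodule.topologicalClosure_eq_top_iff, Submodule.eq_bot_iff]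
    intro v hv
    refine eq_zero_of_inner_coherent v fun α => ?_
    rw [Submodule.mem_orthogonal'] at hv
    exact hv _ ⟨Finsupp.single α 1, by simp [coherentSpan]⟩
  intro x
  have : x ∈ ((LinearMap.range coherentSpan).topologicalClosure : Set Fock) := by
    rw [h]; trivial
  rwa [Submodule.topologicalClosure_coe, LinearMap.coe_range] at this

theorem displacement_coherent (ξ α : ℂ) :
    displacement ξ (coherent α) =
      Complex.exp ((ξ * conj α - conj ξ * α) / 2) • coherent (α + ξ) := by
  have h := LinearMap.extendOfNorm_eq (f := displacedSpan ξ) (e := coherentSpan)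
    denseRange_coherentSpan ⟨1, fun x => by rw [norm_displacedSpan, one_mul]⟩
    (Finsupp.single α 1)
  simpa [displacement, coherentSpan, displacedSpan] using h

theorem displacement_unique (ξ : ℂ) (A : Op)
    (hA : ∀ α, A (coherent α) =
      Complex.exp ((ξ * conj α - conj ξ * α) / 2) • coherent (α + ξ)) :
    A = displacement ξ := by
  refine (LinearMap.extendOfNorm_unique denseRange_coherentSpan 1
    (fun x => by rw [norm_displacedSpan, one_mul]) A ?_).symm
  ext α
  simp [coherentSpan, displacedSpan, hA]

/-! ### Characteristic functions and the diagonal weight -/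

/-- The symmetrically (Weyl) ordered characteristic function `χ_W(ξ) = Tr(T D(ξ))`. -/
def charW (T : TraceClass) (ξ : ℂ) : ℂ := opTrace ((T : Op) ∘L displacement ξ)

/-- The normally ordered characteristic function `χ_N(ξ) = χ_W(ξ) exp(|ξ|²/2)`. -/
def charN (T : TraceClass) (ξ : ℂ) : ℂ := charW T ξ * (Real.exp (‖ξ‖ ^ 2 / 2) : ℂ)

/-- The phase-space (symplectic) Fourier transform `∫ ψ(α) exp(α ξ* - α* ξ) d²α`. -/
def sympFourier (ψ : ℂ → ℂ) (ξ : ℂ) : ℂ :=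
  ∫ α : ℂ, ψ α * Complex.exp (α * conj ξ - conj α * ξ)

/-- The test functions on phase space against which diagonal weights are paired: Schwartz
functions with a compactly supported Fourier transform, that is, the Fourier transforms of
the smooth compactly supported functions. -/
def PhaseTest : Type := {ψ : 𝓢(ℂ, ℂ) // HasCompactSupport (sympFourier ψ)}

/-- Generalized functions on phase space, given by their pairing `⟨φ, ψ⟩ = ∫ φ(α) ψ(α) d²α`
with the test functions. -/
abbrev PhaseFunctional : Type := PhaseTest → ℂ

/-- The (Sudarshan) diagonal weight `φ` of `T`, the generalized function which forms a Fourier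
transform pair with the normally ordered characteristic function:
`φ(α) = π⁻¹ ∫ χ_N(ξ) exp(α ξ* - α* ξ) d²ξ`. It is normalized so that, formally,
`T = π⁻¹ ∫ φ(α) |α⟩⟨α| d²α`. -/
def diagonalWeight (T : TraceClass) : PhaseFunctional := fun ψ =>
  (Real.pi : ℂ)⁻¹ * ∫ ξ : ℂ, charN T ξ * sympFourier ψ.1 ξ

/-- The function `α ↦ ψ(c α)`, as a Schwartz function. -/
def dilateSchwartz (c : ℝ) (hc : c ≠ 0) (ψ : 𝓢(ℂ, ℂ)) : 𝓢(ℂ, ℂ) :=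
  SchwartzMap.compCLMOfContinuousLinearEquiv ℂ
    (LinearEquiv.smulOfNeZero ℝ ℂ c hc).toContinuousLinearEquiv ψ

theorem dilateSchwartz_apply (c : ℝ) (hc : c ≠ 0) (ψ : 𝓢(ℂ, ℂ)) (α : ℂ) :
    dilateSchwartz c hc ψ α = ψ ((c : ℂ) * α) := by
  simp [dilateSchwartz]

theorem sympFourier_dilate (c : ℝ) (hc : c ≠ 0) (ψ : 𝓢(ℂ, ℂ)) (ξ : ℂ) :
    sympFourier (dilateSchwartz c hc ψ) ξ = ((c ^ 2)⁻¹ : ℝ) • sympFourier ψ (c⁻¹ • ξ) := by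
  unfold sympFourier
  have h := Measure.integral_comp_smul (volume : Measure ℂ)
    (fun α : ℂ => ψ α * Complex.exp (α * conj (c⁻¹ • ξ) - conj α * (c⁻¹ • ξ))) c
  rw [Complex.finrank_real_complex, abs_of_nonneg (by positivity)] at h
  rw [← h]
  refine integral_congr_ae (Filter.Eventually.of_forall fun α => ?_)
  have hc' : (c : ℂ) ≠ 0 := by exact_mod_cast hc
  simp only [dilateSchwartz_apply, Complex.real_smul, map_mul, Complex.conj_ofReal,
    Complex.ofReal_inv, map_inv₀]
  congr 2
  field_simp

/-- The test function `α ↦ ψ(c α)`. -/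
def PhaseTest.dilate (c : ℝ) (hc : c ≠ 0) (ψ : PhaseTest) : PhaseTest :=
  ⟨dilateSchwartz c hc ψ.1, by
    have h : sympFourier (dilateSchwartz c hc ψ.1) =
        fun ξ => ((c ^ 2)⁻¹ : ℝ) • sympFourier ψ.1 (c⁻¹ • ξ) :=
      funext (sympFourier_dilate c hc ψ.1)
    rw [h]
    exact HasCompactSupport.smul_left (f := fun _ : ℂ => ((c ^ 2)⁻¹ : ℝ))
      (ψ.2.comp_smul (inv_ne_zero hc))⟩

/-- The scaling `φ(α) ↦ κ⁻² φ(κ⁻¹ α)` of generalized functions on phase space: by a change of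
variables, `∫ κ⁻² φ(κ⁻¹ α) ψ(α) d²α = ∫ φ(α) ψ(κ α) d²α`. -/
def scaleWeight (κ : ℝ) (hκ : κ ≠ 0) (φ : PhaseFunctional) : PhaseFunctional :=
  fun ψ => φ (ψ.dilate κ hκ)

/-- `T = π⁻¹ ∫ φ(α) |α⟩⟨α| d²α` for an ordinary function `φ`, the integral being understood
weakly. -/
def HasWeightFunction (T : TraceClass) (φ : ℂ → ℂ) : Prop :=
  ∀ u v : Fock,
    Integrable (fun α : ℂ => φ α * (⟪u, coherent α⟫_ℂ * ⟪coherent α, v⟫_ℂ)) ∧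
    ⟪u, (T : Op) v⟫_ℂ =
      (Real.pi : ℂ)⁻¹ * ∫ α : ℂ, φ α * (⟪u, coherent α⟫_ℂ * ⟪coherent α, v⟫_ℂ)

/-- Classicality: the diagonal weight is nonnegative, that is, it is a genuine (finite,
nonnegative) measure on the complex plane. -/
def IsClassical (T : TraceClass) : Prop :=
  ∃ μ : Measure ℂ, IsFiniteMeasure μ ∧ ∀ ψ : PhaseTest, diagonalWeight T ψ = ∫ α, ψ.1 α ∂μ

/-! ### Channels -/

/-- Positivity of a `k × k` block operator. -/
def BlockPositive {k : ℕ} (T : Fin k → Fin k → TraceClass) : Prop :=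
  ∀ x : Fin k → Fock, 0 ≤ ∑ i, ∑ j, ⟪x i, (T i j : Op) (x j)⟫_ℂ

/-- Complete positivity of a linear map on the trace class. -/
def IsCP (Φ : TraceClass →ₗ[ℂ] TraceClass) : Prop :=
  ∀ (k : ℕ) (T : Fin k → Fin k → TraceClass),
    BlockPositive T → BlockPositive fun i j => Φ (T i j)

/-- Trace preservation. -/
def IsTP (Φ : TraceClass →ₗ[ℂ] TraceClass) : Prop :=
  ∀ T : TraceClass, opTrace (Φ T) = opTrace T

/-- The Kraus decomposition `Φ(T) = ∑_ℓ B_ℓ T B_ℓ†` (convergence in operator norm), with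
`∑_ℓ B_ℓ† B_ℓ = 1` (strong convergence). -/
def IsKrausDecomposition (B : ℕ → Op) (Φ : TraceClass →ₗ[ℂ] TraceClass) : Prop :=
  (∀ v : Fock, HasSum (fun ℓ => (B ℓ).adjoint (B ℓ v)) v) ∧
  ∀ T : TraceClass, HasSum (fun ℓ => B ℓ ∘L (T : Op) ∘L (B ℓ).adjoint) (Φ T : Op)

/-- The quantum-limited attenuator `𝒞₁(κ)`, through its defining action on characteristic
functions. -/
def IsAttenuator (κ : ℝ) (Φ : TraceClass →ₗ[ℂ] TraceClass) : Prop :=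
  ∀ (T : TraceClass) (ξ : ℂ),
    charW (Φ T) ξ = charW T ((κ : ℂ) * ξ) * (Real.exp (-((1 - κ ^ 2) * ‖ξ‖ ^ 2 / 2)) : ℂ)

/-- The matrix element `⟨m|B_ℓ(κ)|m+ℓ⟩ = √C(m+ℓ, ℓ) (√(1-κ²))^ℓ κ^m`. -/
def krausCoeff (κ : ℝ) (ℓ m : ℕ) : ℝ :=
  Real.sqrt ((m + ℓ).choose ℓ) * Real.sqrt (1 - κ ^ 2) ^ ℓ * κ ^ m

theorem krausCoeff_sq_le_one {κ : ℝ} (hκ : 0 < κ ∧ κ < 1) (ℓ m : ℕ) :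
    krausCoeff κ ℓ m ^ 2 ≤ 1 := by
  have h1 : 0 ≤ 1 - κ ^ 2 := by nlinarith [hκ.1, hκ.2]
  have h2 : krausCoeff κ ℓ m ^ 2 = (1 - κ ^ 2) ^ ℓ * (κ ^ 2) ^ m * ((m + ℓ).choose ℓ : ℝ) := by
    unfold krausCoeff
    rw [mul_pow, mul_pow, Real.sq_sqrt (by positivity), ← pow_mul, mul_comm ℓ 2, pow_mul,
      Real.sq_sqrt h1]
    ring
  have h3 := add_pow (1 - κ ^ 2) (κ ^ 2) (m + ℓ)
  rw [sub_add_cancel, one_pow] at h3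
  rw [h2]
  refine le_of_le_of_eq ?_ h3.symm
  have h4 := Finset.single_le_sum
    (f := fun i => (1 - κ ^ 2) ^ i * (κ ^ 2) ^ (m + ℓ - i) * ((m + ℓ).choose i : ℝ))
    (s := Finset.range (m + ℓ + 1)) (fun i _ => by positivity)
    (Finset.mem_range.2 (show ℓ < m + ℓ + 1 by omega))
  simpa using h4

theorem summable_kraus {κ : ℝ} (hκ : 0 < κ ∧ κ < 1) (ℓ : ℕ) (v : Fock) :
    Summable fun m => ‖(krausCoeff κ ℓ m : ℂ) * (v : ℕ → ℂ) (m + ℓ)‖ ^ 2 := by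
  have hv : Summable fun m => ‖(v : ℕ → ℂ) m‖ ^ 2 := by
    simpa using (lp.memℓp v).summable (by norm_num)
  refine Summable.of_nonneg_of_le (fun m => by positivity) (fun m => ?_)
    ((summable_nat_add_iff ℓ).2 hv)
  rw [norm_mul, mul_pow, Complex.norm_real, Real.norm_eq_abs, sq_abs]
  exact mul_le_of_le_one_left (by positivity) (krausCoeff_sq_le_one hκ ℓ m)

/-- The Kraus operator `B_ℓ(κ) = ∑_m √C(m+ℓ, ℓ) (√(1-κ²))^ℓ κ^m |m⟩⟨m+ℓ|`. -/
def krausB (κ : ℝ) (hκ : 0 < κ ∧ κ < 1) (ℓ : ℕ) : Op :=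
  LinearMap.mkContinuous
    { toFun := fun v => ⟨fun m => (krausCoeff κ ℓ m : ℂ) * (v : ℕ → ℂ) (m + ℓ),
        memℓp_gen (by simpa using summable_kraus hκ ℓ v)⟩
      map_add' := fun v w => by
        ext m
        exact mul_add _ _ _
      map_smul' := fun a v => by
        ext m
        simp
        ring } 1 (fun v => by
      rw [one_mul]
      have hv : Summable fun m => ‖(v : ℕ → ℂ) m‖ ^ 2 := by
        simpa using (lp.memℓp v).summable (by norm_num)
      have key : ∀ w : Fock, ‖w‖ ^ 2 = ∑' m, ‖(w : ℕ → ℂ) m‖ ^ 2 := fun w => by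
        simpa using lp.norm_rpow_eq_tsum (p := 2) (by norm_num) w
      refine le_of_sq_le_sq ?_ (norm_nonneg _)
      rw [key, key]
      calc _ ≤ ∑' m, ‖(v : ℕ → ℂ) (m + ℓ)‖ ^ 2 := by
            refine (summable_kraus hκ ℓ v).tsum_le_tsum (fun m => ?_)
              ((summable_nat_add_iff ℓ).2 hv)
            simp only [LinearMap.coe_mk, AddHom.coe_mk]
            rw [norm_mul, mul_pow, Complex.norm_real, Real.norm_eq_abs, sq_abs]
            exact mul_le_of_le_one_left (by positivity) (krausCoeff_sq_le_one hκ ℓ m)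
        _ ≤ _ := by
            rw [← hv.sum_add_tsum_nat_add ℓ]
            exact le_add_of_nonneg_left (Finset.sum_nonneg fun _ _ => by positivity))

theorem krausB_apply (κ : ℝ) (hκ : 0 < κ ∧ κ < 1) (ℓ : ℕ) (v : Fock) (m : ℕ) :
    (krausB κ hκ ℓ v : ℕ → ℂ) m = (krausCoeff κ ℓ m : ℂ) * (v : ℕ → ℂ) (m + ℓ) := rfl

end

/-!
The map `Φ` is defined by its Kraus series, `Φ(T) = ∑_ℓ B_ℓ T B_ℓ†` (`attenuate`), and everything
is reduced to two facts about the Kraus operators. Completeness, `∑_ℓ B_ℓ† B_ℓ = 1`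
(`krausB_hasSum_adjoint_apply`), is the binomial theorem. The action on coherent states,
`B_ℓ |α⟩ = ⟨ℓ|√(1-κ²) α⟩ |κα⟩` (`krausB_coherent`), says that a beam splitter sends `|α⟩` to
`|κα⟩ ⊗ |√(1-κ²) α⟩`.

Trace-class operators are handled through expansions `T = ∑ᵢ |uᵢ⟩⟨vᵢ|` with square-summable norms
(`TraceClass.exists_nuclearExpansion`). In these terms `Tr(T D(ξ)) = ∑ᵢ ⟨vᵢ, D(ξ) uᵢ⟩`, and `Φ(T)`
has the expansion into `|B_ℓ uᵢ⟩⟨B_ℓ vᵢ|`. Complete positivity and trace preservation are then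
immediate. Since coherent states span a dense subspace, the second fact gives
`∑_ℓ B_ℓ† D(ξ) B_ℓ = e^{-(1-κ²)|ξ|²/2} D(κξ)` (`hasSum_inner_krausB_displacement`), that is,
`χ_N^{Φ(T)}(ξ) = χ_N^T(κξ)`, which is the Fourier transform of the scaling of the diagonal weight.

That the scaling of the weight characterizes `Φ(T)` requires two injectivity statements. The
diagonal weight determines the continuous function `χ_N`, because every smooth compactly supported
function is the Fourier transform of a test function (`exists_phaseTest_sympFourier_eq`). The
characteristic function determines `T`, because the Gaussian averages
`∫ e^{-|ξ|²/2 + a ξ* - b* ξ} D(ξ) d²ξ` are nonzero multiples of `|a⟩⟨b|`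
(`integral_displacementKernel_smul`), so that all coherent-state matrix elements of `T` are
integrals of `χ_W`.

For an ordinary weight function the Kraus series is integrated term by term. Absolute convergence
comes from the closed graph theorem, which bounds `∫ |φ(α)| |⟨α|u⟩|² d²α` by a multiple of `‖u‖²`
(`exists_integral_weight_le`), together with `∑_ℓ B_ℓ B_ℓ† = κ⁻²`
(`krausB_summable_adjoint_norm_sq`). Classicality is transported in both directions by pushing the
representing measure forward along dilations.
-/

/-! ### Nuclear expansions of trace-class operators -/

/-- `T = ∑ᵢ |uᵢ⟩⟨vᵢ|` strongly, with square-summable families `‖uᵢ‖` and `‖vᵢ‖`. The index type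
is arbitrary, so that sums and images under Kraus maps can be indexed by sums and products. -/
structure IsNuclearExpansion {ι : Type} (u v : ι → Fock) (T : Op) : Prop where
  summable_left : Summable fun i => ‖u i‖ ^ 2
  summable_right : Summable fun i => ‖v i‖ ^ 2
  hasSum : ∀ x, HasSum (fun i => ⟪v i, x⟫_ℂ • u i) (T x)

theorem inner_fock_left (n : ℕ) (x : Fock) : ⟪fock n, x⟫_ℂ = (x : ℕ → ℂ) n := by
  rw [fock, lp.inner_single_left]; simp

theorem Fock.hasSum_norm_sq (x : Fock) : HasSum (fun n => ‖(x : ℕ → ℂ) n‖ ^ 2) (‖x‖ ^ 2) := by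
  simpa using lp.hasSum_norm (p := 2) (by norm_num) x

theorem Fock.hasSum_fock (x : Fock) : HasSum (fun n => ⟪fock n, x⟫_ℂ • fock n) x := by
  have h := lp.hasSum_single (E := fun _ : ℕ => ℂ) (p := 2) (by norm_num) x
  have he : (fun n => ⟪fock n, x⟫_ℂ • fock n) = fun n => lp.single 2 n ((x : ℕ → ℂ) n) := by
    funext n
    rw [inner_fock_left, fock, ← lp.single_smul, smul_eq_mul, mul_one]
  rw [he]
  exact h

theorem mul_le_half_add_sq (a b : ℝ) : a * b ≤ (a ^ 2 + b ^ 2) / 2 := by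
  nlinarith [sq_nonneg (a - b)]

theorem summable_mul_of_summable_sq {ι : Type} {a b : ι → ℝ} (ha : Summable fun i => a i ^ 2)
    (hb : Summable fun i => b i ^ 2) (ha0 : ∀ i, 0 ≤ a i) (hb0 : ∀ i, 0 ≤ b i) :
    Summable fun i => a i * b i :=
  Summable.of_nonneg_of_le (fun i => mul_nonneg (ha0 i) (hb0 i))
    (fun _ => mul_le_half_add_sq _ _) ((ha.add hb).div_const 2)

theorem summable_inner_sq {ι : Type} {u : ι → Fock} (hu : Summable fun i => ‖u i‖ ^ 2) :
    Summable fun p : ι × ℕ => ‖⟪fock p.2, u p.1⟫_ℂ‖ ^ 2 := by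
  have h0 : ∀ i, HasSum (fun n => ‖⟪fock n, u i⟫_ℂ‖ ^ 2) (‖u i‖ ^ 2) := fun i => by
    simpa only [inner_fock_left] using Fock.hasSum_norm_sq (u i)
  refine (summable_prod_of_nonneg fun _ => sq_nonneg _).2 ⟨fun i => (h0 i).summable, ?_⟩
  exact hu.congr fun i => (h0 i).tsum_eq.symm

namespace IsNuclearExpansion

variable {ι : Type} {u v : ι → Fock} {T : Op}

/-- The diagonal sum defining the trace of `∑ᵢ |uᵢ⟩⟨vᵢ|` converges, and the trace is
`∑ᵢ ⟨vᵢ, uᵢ⟩`. -/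
theorem trace (h : IsNuclearExpansion u v T) :
    (Summable fun n => ⟪fock n, T (fock n)⟫_ℂ) ∧
      HasSum (fun i => ⟪v i, u i⟫_ℂ) (opTrace T) := by
  have hs : Summable fun p : ι × ℕ => ⟪v p.1, fock p.2⟫_ℂ * ⟪fock p.2, u p.1⟫_ℂ := by
    refine Summable.of_norm_bounded (summable_mul_of_summable_sq (summable_inner_sq h.summable_right)
      (summable_inner_sq h.summable_left) (fun _ => norm_nonneg _) (fun _ => norm_nonneg _))
      fun p => ?_
    rw [norm_mul, norm_inner_symm]
  have h1 : ∀ i, HasSum (fun n => ⟪v i, fock n⟫_ℂ * ⟪fock n, u i⟫_ℂ) ⟪v i, u i⟫_ℂ := by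
    intro i
    have := (Fock.hasSum_fock (u i)).mapL (innerSL ℂ (v i))
    simpa [mul_comm] using this
  have h2 : ∀ n, HasSum (fun i => ⟪v i, fock n⟫_ℂ * ⟪fock n, u i⟫_ℂ) ⟪fock n, T (fock n)⟫_ℂ := by
    intro n
    have := (h.hasSum (fock n)).mapL (innerSL ℂ (fock n))
    simpa using this
  have h3 := hs.hasSum.prod_fiberwise h1
  have h4 := ((Equiv.prodComm ℕ ι).hasSum_iff.2 hs.hasSum).prod_fiberwise h2
  refine ⟨h4.summable, ?_⟩
  rw [opTrace, h4.tsum_eq]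
  exact h3

theorem comp_right (h : IsNuclearExpansion u v T) (A : Op) :
    IsNuclearExpansion u (fun i => A.adjoint (v i)) (T ∘L A) where
  summable_left := h.summable_left
  summable_right := by
    refine Summable.of_nonneg_of_le (fun _ => by positivity) (fun i => ?_)
      (h.summable_right.mul_left (‖A.adjoint‖ ^ 2))
    rw [← mul_pow]
    gcongr
    exact A.adjoint.le_opNorm _
  hasSum x := by
    simp only [ContinuousLinearMap.adjoint_inner_left]
    exact h.hasSum (A x)

theorem smul (h : IsNuclearExpansion u v T) (c : ℂ) :
    IsNuclearExpansion (fun i => c • u i) v (c • T) where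
  summable_left := by simpa [norm_smul, mul_pow] using h.summable_left.mul_left (‖c‖ ^ 2)
  summable_right := h.summable_right
  hasSum x := by
    simpa only [smul_comm c, smul_apply] using (h.hasSum x).const_smul c

theorem add {ι' : Type} {u' v' : ι' → Fock} {T' : Op} (h : IsNuclearExpansion u v T)
    (h' : IsNuclearExpansion u' v' T') :
    IsNuclearExpansion (Sum.elim u u') (Sum.elim v v') (T + T') where
  summable_left := (HasSum.sum (f := fun i => ‖Sum.elim u u' i‖ ^ 2)
    h.summable_left.hasSum h'.summable_left.hasSum).summable
  summable_right := (HasSum.sum (f := fun i => ‖Sum.elim v v' i‖ ^ 2)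
    h.summable_right.hasSum h'.summable_right.hasSum).summable
  hasSum x := by
    have h1 := h.hasSum x
    have h2 := h'.hasSum x
    exact HasSum.sum (f := fun i => ⟪Sum.elim v v' i, x⟫_ℂ • Sum.elim u u' i) h1 h2

end IsNuclearExpansion

theorem ContinuousLinearMap.IsPositive.exists_sqrt {H : Type} [NormedAddCommGroup H]
    [InnerProductSpace ℂ H] [CompleteSpace H] {A : H →L[ℂ] H} (hA : A.IsPositive) :
    ∃ R : H →L[ℂ] H, (∀ x, R (R x) = A x) ∧ ∀ x y, ⟪R x, y⟫_ℂ = ⟪x, R y⟫_ℂ := by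
  have hA' : 0 ≤ A := (ContinuousLinearMap.nonneg_iff_isPositive A).2 hA
  refine ⟨CFC.sqrt A, fun x => ?_, ?_⟩
  · rw [← mul_apply_eq_comp, CFC.sqrt_mul_sqrt_self A hA']
  · exact ((ContinuousLinearMap.nonneg_iff_isPositive _).1 (CFC.sqrt_nonneg A)).isSymmetric

/-- With `R` the positive square root of `A`, the expansion is `A = ∑ₙ R|n⟩⟨n|R`. -/
theorem exists_nuclearExpansion_of_isPositive {A : Op} (hA : A.IsPositive)
    (hs : Summable fun n => ⟪fock n, A (fock n)⟫_ℂ) :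
    ∃ u : ℕ → Fock, IsNuclearExpansion u u A := by
  obtain ⟨R, hRR, hsym⟩ := hA.exists_sqrt
  have hn : Summable fun n => ‖R (fock n)‖ ^ 2 := by
    refine (Complex.reCLM.summable hs).congr fun n => ?_
    rw [← hRR, ← hsym, inner_self_eq_norm_sq_to_K]
    simp [← Complex.ofReal_pow]
  refine ⟨fun n => R (fock n), hn, hn, fun x => ?_⟩
  have h := (Fock.hasSum_fock (R x)).mapL R
  simp only [map_smul, hRR, ← hsym] at h
  exact h

/-- Every trace-class operator has a nuclear expansion. Index types of sums are disjoint unions. -/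
theorem TraceClass.exists_nuclearExpansion (T : TraceClass) :
    ∃ (ι : Type) (_ : Countable ι) (u v : ι → Fock), IsNuclearExpansion u v (T : Op) := by
  obtain ⟨T, hT⟩ := T
  induction hT using Submodule.span_induction with
  | mem A hA =>
    obtain ⟨u, hu⟩ := exists_nuclearExpansion_of_isPositive hA.1 hA.2
    exact ⟨ℕ, inferInstance, u, u, hu⟩
  | zero =>
    exact ⟨Empty, inferInstance, fun _ => 0, fun _ => 0, summable_empty, summable_empty,
      fun x => hasSum_empty⟩
  | add S T _ _ hS hT =>
    obtain ⟨ι, _, u, v, h⟩ := hS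
    obtain ⟨κ, _, u', v', h'⟩ := hT
    exact ⟨ι ⊕ κ, inferInstance, _, _, h.add h'⟩
  | smul c T _ hT =>
    obtain ⟨ι, _, u, v, h⟩ := hT
    exact ⟨ι, inferInstance, _, _, h.smul c⟩

/-- In terms of a nuclear expansion, `Tr(T D(ξ)) = ∑ᵢ ⟨vᵢ, D(ξ) uᵢ⟩`. -/
theorem charW_hasSum {ι : Type} {u v : ι → Fock} {T : TraceClass}
    (h : IsNuclearExpansion u v (T : Op)) (ξ : ℂ) :
    HasSum (fun i => ⟪v i, displacement ξ (u i)⟫_ℂ) (charW T ξ) := by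
  rw [charW]
  simpa only [ContinuousLinearMap.adjoint_inner_left] using (h.comp_right (displacement ξ)).trace.2

/-! ### Completeness relations of the Kraus operators -/

theorem krausCoeff_sq {κ : ℝ} (hκ : 0 < κ ∧ κ < 1) (ℓ m : ℕ) :
    krausCoeff κ ℓ m ^ 2 = (m + ℓ).choose ℓ * ((1 - κ ^ 2) ^ ℓ * (κ ^ 2) ^ m) := by
  have h1 : 0 ≤ 1 - κ ^ 2 := by nlinarith [hκ.1, hκ.2]
  rw [krausCoeff, mul_pow, mul_pow, Real.sq_sqrt (by positivity), ← pow_mul, mul_comm ℓ 2,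
    pow_mul, Real.sq_sqrt h1]
  ring

/-- The binomial theorem, as a normalization of the Kraus coefficients of fixed `m + ℓ`. -/
theorem sum_antidiagonal_krausCoeff_sq {κ : ℝ} (hκ : 0 < κ ∧ κ < 1) (n : ℕ) :
    ∑ p ∈ Finset.HasAntidiagonal.antidiagonal n, krausCoeff κ p.1 p.2 ^ 2 = 1 := by
  have h := (Commute.all (1 - κ ^ 2) (κ ^ 2)).add_pow' n
  rw [sub_add_cancel, one_pow] at h
  rw [h]
  refine Finset.sum_congr rfl fun p hp => ?_
  rw [krausCoeff_sq hκ, nsmul_eq_mul, add_comm, Finset.HasAntidiagonal.mem_antidiagonal.1 hp]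

theorem krausB_norm_sq {κ : ℝ} (hκ : 0 < κ ∧ κ < 1) (ℓ : ℕ) (v : Fock) :
    HasSum (fun m => krausCoeff κ ℓ m ^ 2 * ‖(v : ℕ → ℂ) (m + ℓ)‖ ^ 2)
      (‖krausB κ hκ ℓ v‖ ^ 2) := by
  have h := Fock.hasSum_norm_sq (krausB κ hκ ℓ v)
  have he : ∀ m, ‖(krausB κ hκ ℓ v : ℕ → ℂ) m‖ ^ 2
      = krausCoeff κ ℓ m ^ 2 * ‖(v : ℕ → ℂ) (m + ℓ)‖ ^ 2 := fun m => by
    rw [krausB_apply, norm_mul, mul_pow, Complex.norm_real, Real.norm_eq_abs, sq_abs]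
  simpa only [he] using h

theorem hasSum_prod_of_hasSum_antidiagonal {f : ℕ × ℕ → ℝ} {g : ℕ → ℝ} {a : ℝ}
    (hf : ∀ p, 0 ≤ f p)
    (hfg : ∀ n, ∑ p ∈ Finset.HasAntidiagonal.antidiagonal n, f p = g n) (hg : HasSum g a) :
    HasSum f a := by
  let e := Finset.HasAntidiagonal.sigmaAntidiagonalEquivProd (A := ℕ)
  have hfib : ∀ n, HasSum
      (fun p : ↥(Finset.HasAntidiagonal.antidiagonal n) => f (e ⟨n, p⟩)) (g n) := fun n => by
    rw [← hfg n]
    exact Finset.hasSum _ f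
  refine e.hasSum_iff.1 (HasSum.sigma_of_hasSum hg hfib ?_)
  refine (summable_sigma_of_nonneg fun _ => hf _).2 ⟨fun n => (hfib n).summable, ?_⟩
  exact hg.summable.congr fun n => (hfib n).tsum_eq.symm

theorem krausB_hasSum_norm_sq {κ : ℝ} (hκ : 0 < κ ∧ κ < 1) (v : Fock) :
    HasSum (fun ℓ => ‖krausB κ hκ ℓ v‖ ^ 2) (‖v‖ ^ 2) := by
  have hf : ∀ p : ℕ × ℕ, 0 ≤ krausCoeff κ p.1 p.2 ^ 2 * ‖(v : ℕ → ℂ) (p.2 + p.1)‖ ^ 2 :=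
    fun _ => mul_nonneg (sq_nonneg _) (sq_nonneg _)
  have hfg : ∀ n, ∑ p ∈ Finset.HasAntidiagonal.antidiagonal n,
      krausCoeff κ p.1 p.2 ^ 2 * ‖(v : ℕ → ℂ) (p.2 + p.1)‖ ^ 2 = ‖(v : ℕ → ℂ) n‖ ^ 2 := by
    intro n
    rw [← one_mul (‖(v : ℕ → ℂ) n‖ ^ 2), ← sum_antidiagonal_krausCoeff_sq hκ n, Finset.sum_mul]
    refine Finset.sum_congr rfl fun p hp => ?_
    rw [add_comm, Finset.HasAntidiagonal.mem_antidiagonal.1 hp]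
  have h := hasSum_prod_of_hasSum_antidiagonal hf hfg (Fock.hasSum_norm_sq v)
  exact h.prod_fiberwise fun ℓ => krausB_norm_sq hκ ℓ v

/-- Strong convergence of `∑_ℓ B_ℓ† B_ℓ = 1`. A partial sum `p` applied to `v` satisfies
`‖p‖² ≤ ∑ ‖B_ℓ v‖² = re ⟨v, p⟩`, so `‖v - p‖² ≤ ‖v‖² - ∑ ‖B_ℓ v‖²`, which tends to zero. -/
theorem krausB_hasSum_adjoint_apply {κ : ℝ} (hκ : 0 < κ ∧ κ < 1) (v : Fock) :
    HasSum (fun ℓ => (krausB κ hκ ℓ).adjoint (krausB κ hκ ℓ v)) v := by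
  have hlim := krausB_hasSum_norm_sq hκ v
  have key : ∀ s : Finset ℕ, ‖∑ ℓ ∈ s, (krausB κ hκ ℓ).adjoint (krausB κ hκ ℓ v) - v‖ ^ 2
      ≤ ‖v‖ ^ 2 - ∑ ℓ ∈ s, ‖krausB κ hκ ℓ v‖ ^ 2 := by
    intro s
    set p := ∑ ℓ ∈ s, (krausB κ hκ ℓ).adjoint (krausB κ hκ ℓ v) with hp
    have hin : ∀ w, ⟪w, p⟫_ℂ = ∑ ℓ ∈ s, ⟪krausB κ hκ ℓ w, krausB κ hκ ℓ v⟫_ℂ := fun w => by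
      rw [hp, inner_sum]
      simp only [ContinuousLinearMap.adjoint_inner_right]
    have h1 : RCLike.re ⟪v, p⟫_ℂ = ∑ ℓ ∈ s, ‖krausB κ hκ ℓ v‖ ^ 2 := by
      rw [hin, map_sum]
      simp only [inner_self_eq_norm_sq]
    have h2 : ‖p‖ ^ 2 ≤ ∑ ℓ ∈ s, (‖krausB κ hκ ℓ p‖ ^ 2 + ‖krausB κ hκ ℓ v‖ ^ 2) / 2 := by
      rw [← inner_self_eq_norm_sq (𝕜 := ℂ), hin p, map_sum]
      refine Finset.sum_le_sum fun ℓ _ => (re_inner_le_norm _ _).trans ?_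
      exact mul_le_half_add_sq _ _
    rw [← Finset.sum_div, Finset.sum_add_distrib] at h2
    have h3 : ∑ ℓ ∈ s, ‖krausB κ hκ ℓ p‖ ^ 2 ≤ ‖p‖ ^ 2 :=
      sum_le_hasSum s (fun _ _ => by positivity) (krausB_hasSum_norm_sq hκ p)
    rw [norm_sub_rev, @norm_sub_sq ℂ, h1]
    linarith
  have h0 : Filter.Tendsto (fun s : Finset ℕ => ‖v‖ ^ 2 - ∑ ℓ ∈ s, ‖krausB κ hκ ℓ v‖ ^ 2)
      Filter.atTop (nhds 0) := by
    rw [← sub_self (‖v‖ ^ 2)]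
    exact tendsto_const_nhds.sub hlim
  rw [HasSum, tendsto_iff_norm_sub_tendsto_zero]
  have h4 := squeeze_zero (fun _ => sq_nonneg _) key h0
  simpa [Real.sqrt_sq] using h4.sqrt

theorem krausB_hasSum_inner {κ : ℝ} (hκ : 0 < κ ∧ κ < 1) (v w : Fock) :
    HasSum (fun ℓ => ⟪krausB κ hκ ℓ w, krausB κ hκ ℓ v⟫_ℂ) ⟪w, v⟫_ℂ := by
  have h := (krausB_hasSum_adjoint_apply hκ v).mapL (innerSL ℂ w)
  simpa only [innerSL_apply_apply, ContinuousLinearMap.adjoint_inner_right] using h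

/-- `B_ℓ† |m⟩` is the Kraus coefficient times `|m+ℓ⟩`, in terms of norms. -/
theorem krausB_adjoint_norm_sq {κ : ℝ} (hκ : 0 < κ ∧ κ < 1) (ℓ : ℕ) (u : Fock) :
    HasSum (fun m => krausCoeff κ ℓ m ^ 2 * ‖(u : ℕ → ℂ) m‖ ^ 2)
      (‖(krausB κ hκ ℓ).adjoint u‖ ^ 2) := by
  have hcoord : ∀ n, ((krausB κ hκ ℓ).adjoint u : ℕ → ℂ) n = ⟪krausB κ hκ ℓ (fock n), u⟫_ℂ :=
    fun n => by rw [← inner_fock_left, ContinuousLinearMap.adjoint_inner_right]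
  have hlow : ∀ n < ℓ, krausB κ hκ ℓ (fock n) = 0 := fun n hn => by
    ext m
    rw [krausB_apply, fock, lp.single_apply_ne 2 n 1 (by omega)]
    simp
  have hhigh : ∀ m, krausB κ hκ ℓ (fock (m + ℓ)) = (krausCoeff κ ℓ m : ℂ) • fock m := fun m => by
    ext k
    rw [krausB_apply, lp.coeFn_smul, Pi.smul_apply, fock, fock]
    by_cases hk : k = m
    · subst hk
      rw [lp.single_apply_self, lp.single_apply_self, smul_eq_mul]
    · rw [lp.single_apply_ne 2 _ _ (by omega), lp.single_apply_ne 2 _ _ hk]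
      simp
  have h := Fock.hasSum_norm_sq ((krausB κ hκ ℓ).adjoint u)
  rw [← add_zero (‖(krausB κ hκ ℓ).adjoint u‖ ^ 2)] at h
  have hz : ∑ n ∈ Finset.range ℓ, ‖((krausB κ hκ ℓ).adjoint u : ℕ → ℂ) n‖ ^ 2 = 0 :=
    Finset.sum_eq_zero fun n hn => by
      rw [hcoord, hlow n (Finset.mem_range.1 hn), inner_zero_left]; simp
  rw [← hz] at h
  refine ((hasSum_nat_add_iff ℓ).2 h).congr_fun fun m => ?_
  rw [hcoord, hhigh, inner_smul_left, inner_fock_left, norm_mul, mul_pow]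
  simp

/-- A consequence of `∑_ℓ B_ℓ B_ℓ† = κ⁻²`, which is the negative binomial series. -/
theorem krausB_summable_adjoint_norm_sq {κ : ℝ} (hκ : 0 < κ ∧ κ < 1) (u : Fock) :
    Summable fun ℓ => ‖(krausB κ hκ ℓ).adjoint u‖ ^ 2 := by
  have hκ2 : 0 < κ ^ 2 := pow_pos hκ.1 2
  have hκ1 : κ ^ 2 < 1 := by nlinarith [hκ.1, hκ.2]
  have hcol : ∀ m, HasSum (fun ℓ => krausCoeff κ ℓ m ^ 2 * ‖(u : ℕ → ℂ) m‖ ^ 2)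
      ((κ ^ 2)⁻¹ * ‖(u : ℕ → ℂ) m‖ ^ 2) := fun m => by
    have h1 := (hasSum_choose_mul_geometric_of_norm_lt_one m (r := 1 - κ ^ 2)
      (by rw [Real.norm_eq_abs, abs_lt]; constructor <;> linarith)).mul_left ((κ ^ 2) ^ m)
    have h2 : (κ ^ 2) ^ m * (1 / (1 - (1 - κ ^ 2)) ^ (m + 1)) = (κ ^ 2)⁻¹ := by
      rw [sub_sub_cancel, pow_succ _ m, one_div, mul_inv, mul_inv_cancel_left₀ (pow_pos hκ2 m).ne']
    rw [h2] at h1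
    refine (h1.mul_right (‖(u : ℕ → ℂ) m‖ ^ 2)).congr_fun fun ℓ => ?_
    rw [krausCoeff_sq hκ, add_comm m ℓ, Nat.choose_symm_add]
    ring
  have hs : Summable fun p : ℕ × ℕ => krausCoeff κ p.2 p.1 ^ 2 * ‖(u : ℕ → ℂ) p.1‖ ^ 2 := by
    refine (summable_prod_of_nonneg fun p => by positivity).2 ⟨fun m => (hcol m).summable, ?_⟩
    exact ((Fock.hasSum_norm_sq u).summable.mul_left _).congr fun m => (hcol m).tsum_eq.symm
  exact (((Equiv.prodComm ℕ ℕ).hasSum_iff.2 hs.hasSum).prod_fiberwise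
    fun ℓ => krausB_adjoint_norm_sq hκ ℓ u).summable

/-! ### Coherent states under the Kraus operators -/

theorem one_sub_sq_nonneg {κ : ℝ} (hκ : 0 < κ ∧ κ < 1) : 0 ≤ 1 - κ ^ 2 := by
  nlinarith [hκ.1, hκ.2]

/-- A Kraus operator maps a coherent state to a multiple of the attenuated coherent state; the
factor is the amplitude of finding `ℓ` quanta in the lost mode, in the coherent state
`|√(1-κ²) α⟩`. -/
theorem krausB_coherent {κ : ℝ} (hκ : 0 < κ ∧ κ < 1) (ℓ : ℕ) (α : ℂ) :
    krausB κ hκ ℓ (coherent α) =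
      coherentCoeff ((Real.sqrt (1 - κ ^ 2) : ℝ) * α) ℓ • coherent ((κ : ℂ) * α) := by
  have hs : Real.sqrt (1 - κ ^ 2) ^ 2 = 1 - κ ^ 2 := Real.sq_sqrt (one_sub_sq_nonneg hκ)
  ext m
  rw [krausB_apply, lp.coeFn_smul, Pi.smul_apply, coherent_apply, coherent_apply, smul_eq_mul]
  have hexp : Real.exp (-‖α‖ ^ 2 / 2) = Real.exp (-‖((Real.sqrt (1 - κ ^ 2) : ℝ) : ℂ) * α‖ ^ 2 / 2)
      * Real.exp (-‖(κ : ℂ) * α‖ ^ 2 / 2) := by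
    rw [← Real.exp_add, norm_mul, norm_mul, mul_pow, mul_pow, Complex.norm_real,
      Complex.norm_real, Real.norm_eq_abs, Real.norm_eq_abs, sq_abs, sq_abs, hs]
    congr 1
    ring
  have hfac : Real.sqrt ((m + ℓ).choose ℓ) * (Real.sqrt m.factorial * Real.sqrt ℓ.factorial) =
      Real.sqrt (m + ℓ).factorial := by
    rw [← Real.sqrt_mul (by positivity), ← Real.sqrt_mul (by positivity)]
    congr 1
    have := Nat.add_choose_mul_factorial_mul_factorial m ℓ
    rw [← this]
    push_cast
    ring
  have hne : ∀ n : ℕ, ((Real.sqrt n.factorial : ℝ) : ℂ) ≠ 0 := fun n => by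
    have : (0 : ℝ) < Real.sqrt n.factorial := Real.sqrt_pos.2 (by positivity)
    exact_mod_cast this.ne'
  rw [coherentCoeff, coherentCoeff, coherentCoeff, hexp, krausCoeff]
  have h1 := hne m
  have h2 := hne ℓ
  have h3 := hne (m + ℓ)
  rw [← hfac] at h3 ⊢
  push_cast at h3 ⊢
  have h4 := left_ne_zero_of_mul h3
  field_simp
  ring

/-! ### Displacement operators and injectivity of the characteristic function -/

theorem dense_span_coherent :
    Dense (Submodule.span ℂ (Set.range coherent) : Set Fock) := by
  have h := denseRange_coherentSpan
  rwa [DenseRange, ← LinearMap.coe_range, coherentSpan, Finsupp.range_linearCombination] at h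

theorem Fock.ext_inner_coherent {x y : Fock} (h : ∀ α, ⟪coherent α, x⟫_ℂ = ⟪coherent α, y⟫_ℂ) :
    x = y := by
  rw [← sub_eq_zero]
  refine eq_zero_of_inner_coherent _ fun α => ?_
  rw [← inner_conj_symm, inner_sub_right, h, sub_self, map_zero]

theorem Op.ext_coherent {A B : Op} (h : ∀ α, A (coherent α) = B (coherent α)) : A = B :=
  ContinuousLinearMap.ext_on dense_span_coherent (by rintro _ ⟨α, rfl⟩; exact h α)

theorem norm_displacement_le (ξ : ℂ) (u : Fock) : ‖displacement ξ u‖ ≤ ‖u‖ := by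
  have h := LinearMap.norm_extendOfNorm_apply_le (f := displacedSpan ξ) (e := coherentSpan)
    denseRange_coherentSpan 1 (fun x => by rw [norm_displacedSpan, one_mul]) u
  rwa [one_mul] at h

theorem norm_sq_coherent (α : ℂ) : ‖coherent α‖ ^ 2 = 1 := by
  have h1 := inner_coherent α α
  rw [inner_self_eq_norm_sq_to_K, Complex.conj_mul'] at h1
  have h2 : ((‖coherent α‖ ^ 2 : ℝ) : ℂ) = 1 := by
    rw [Complex.ofReal_pow]
    refine h1.trans ?_
    rw [← Complex.exp_zero]
    congr 1
    ring
  exact_mod_cast h2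

theorem hasSum_norm_sq_coherentCoeff (α : ℂ) : HasSum (fun n => ‖coherentCoeff α n‖ ^ 2) 1 := by
  rw [← norm_sq_coherent α]
  exact Fock.hasSum_norm_sq (coherent α)

theorem continuous_coherent : Continuous coherent := by
  have h : ∀ α β, ‖coherent β - coherent α‖ ^ 2 =
      ‖coherent β‖ ^ 2 - 2 * RCLike.re ⟪coherent β, coherent α⟫_ℂ + ‖coherent α‖ ^ 2 :=
    fun α β => @norm_sub_sq ℂ _ _ _ _ _ _
  have hn := norm_sq_coherent
  refine continuous_iff_continuousAt.2 fun α => ?_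
  rw [ContinuousAt, tendsto_iff_norm_sub_tendsto_zero]
  have hc : Continuous fun β => ‖coherent β - coherent α‖ ^ 2 := by
    simp only [h, hn, inner_coherent]
    fun_prop
  have h3 := (hc.tendsto α).sqrt
  simpa [Real.sqrt_sq] using h3

/-- The displacement operators are strongly continuous: on coherent states this is explicit, and
it extends to the closed span because they are contractions. -/
theorem continuous_displacement_apply (u : Fock) : Continuous fun ξ => displacement ξ u := by
  have hspan : ∀ w ∈ Submodule.span ℂ (Set.range coherent),
      Continuous fun ξ => displacement ξ w := by
    intro w hw
    induction hw using Submodule.span_induction with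
    | mem x hx =>
      obtain ⟨α, rfl⟩ := hx
      simp only [displacement_coherent]
      have h1 : Continuous fun ξ : ℂ => coherent (α + ξ) :=
        continuous_coherent.comp (continuous_const.add continuous_id)
      have h2 : Continuous fun ξ : ℂ => Complex.exp ((ξ * conj α - conj ξ * α) / 2) := by
        fun_prop
      exact h2.smul h1
    | zero => simpa only [map_zero] using continuous_const
    | add x y _ _ hx hy =>
      simp only [map_add]
      exact hx.add hy
    | smul c x _ hx =>
      simp only [map_smul]
      exact hx.const_smul c
  refine Metric.continuous_iff'.2 fun ξ ε hε => ?_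
  obtain ⟨w, hw, hwu⟩ := Metric.dense_iff.1 dense_span_coherent u (ε / 3) (by positivity)
  have hd : ∀ η, ‖displacement η w - displacement η u‖ < ε / 3 := fun η => by
    rw [← map_sub]
    refine (norm_displacement_le η _).trans_lt ?_
    rwa [← mem_ball_iff_norm]
  filter_upwards [Metric.continuous_iff'.1 (hspan w hwu) ξ (ε / 3) (by positivity)] with η hη
  rw [dist_eq_norm] at hη ⊢
  have h1 : displacement η u - displacement ξ u = -(displacement η w - displacement η u) +
      (displacement η w - displacement ξ w) + (displacement ξ w - displacement ξ u) := by abel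
  rw [h1]
  refine (norm_add₃_le).trans_lt ?_
  rw [norm_neg]
  linarith [hd η, hd ξ]

theorem continuous_charW (T : TraceClass) : Continuous (charW T) := by
  obtain ⟨ι, _, u, v, h⟩ := TraceClass.exists_nuclearExpansion T
  have he : charW T = fun ξ => ∑' i, ⟪v i, displacement ξ (u i)⟫_ℂ :=
    funext fun ξ => (charW_hasSum h ξ).tsum_eq.symm
  rw [he]
  refine continuous_tsum (fun i => ?_) (summable_mul_of_summable_sq h.summable_right h.summable_left
    (fun _ => norm_nonneg _) (fun _ => norm_nonneg _)) fun i ξ => ?_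
  · exact continuous_const.inner (continuous_displacement_apply (u i))
  · refine (norm_inner_le_norm _ _).trans ?_
    gcongr
    exact norm_displacement_le ξ _

theorem continuous_charN (T : TraceClass) : Continuous (charN T) := by
  have h := continuous_charW T
  unfold charN
  fun_prop

/-- Matrix elements of the displacement operator between coherent states. -/
theorem inner_coherent_displacement (ξ α β : ℂ) :
    ⟪coherent α, displacement ξ (coherent β)⟫_ℂ = ⟪coherent α, coherent β⟫_ℂ *
      Complex.exp (-(ξ * conj ξ) / 2 - conj ξ * β + conj α * ξ) := by
  rw [displacement_coherent, inner_smul_right, inner_coherent, inner_coherent,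
    ← Complex.exp_add, ← Complex.exp_add]
  congr 1
  simp only [← Complex.conj_mul', map_add]
  ring

/-- The Gaussian with independent coefficients of `z` and `z*`, in real coordinates. -/
theorem cexp_gaussian_eq (a b z : ℂ) :
    Complex.exp (-(z * conj z) + a * conj z + b * z) =
      Complex.exp (-1 * ∑ i, ((Complex.measurableEquivPi z i : ℝ) : ℂ) ^ 2 +
        ∑ i, ![a + b, Complex.I * (b - a)] i * ((Complex.measurableEquivPi z i : ℝ) : ℂ)) := by
  congr 1
  simp only [Fin.sum_univ_two, Complex.measurableEquivPi_apply, Matrix.cons_val_zero,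
    Matrix.cons_val_one]
  conv_lhs => rw [Complex.mul_conj, Complex.normSq_apply]
  have h1 : z = z.re + z.im * Complex.I := (Complex.re_add_im z).symm
  have h2 : conj z = z.re - z.im * Complex.I := by
    apply Complex.ext <;> simp
  rw [h2]
  conv_lhs => enter [2, 2]; rw [h1]
  push_cast
  ring

theorem integral_cexp_gaussian (a b : ℂ) :
    ∫ z : ℂ, Complex.exp (-(z * conj z) + a * conj z + b * z) = Real.pi * Complex.exp (a * b) := by
  simp only [cexp_gaussian_eq]
  have h := Complex.volume_preserving_equiv_pi.integral_comp'
    (fun v : Fin 2 → ℝ => Complex.exp (-1 * ∑ i, ((v i : ℝ) : ℂ) ^ 2 +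
        ∑ i, ![a + b, Complex.I * (b - a)] i * ((v i : ℝ) : ℂ)))
  refine h.trans ?_
  rw [GaussianFourier.integral_cexp_neg_mul_sum_add (by norm_num)]
  simp only [Fin.sum_univ_two, Matrix.cons_val_zero, Matrix.cons_val_one, Fintype.card_fin]
  congr 1
  · norm_num
  · congr 1
    linear_combination (b - a) ^ 2 / 4 * Complex.I_sq

theorem integrable_cexp_gaussian (a b : ℂ) :
    Integrable fun z : ℂ => Complex.exp (-(z * conj z) / 2 + a * conj z + b * z) := by
  have h : Integrable fun z : ℂ => Complex.exp (-(1 / 2 : ℂ) * ‖z‖ ^ 2 + 1 * ⟪conj b + a, z⟫_ℝ) :=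
    GaussianFourier.integrable_cexp_neg_mul_sq_norm_add (by norm_num) 1 (conj b + a)
  refine h.mono (by fun_prop) (Filter.Eventually.of_forall fun z => le_of_eq ?_)
  rw [Complex.norm_exp, Complex.norm_exp]
  congr 1
  have h1 : z * conj z = ((‖z‖ ^ 2 : ℝ) : ℂ) := by rw [Complex.mul_conj']; norm_cast
  have h2 : ((‖z‖ : ℂ)) ^ 2 = ((‖z‖ ^ 2 : ℝ) : ℂ) := by norm_cast
  rw [h1, h2, Complex.inner]
  simp
  ring

/-- The Gaussian kernel whose average over the displacement operators is a multiple of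
`|a⟩⟨b|`. -/
noncomputable def displacementKernel (a b ξ : ℂ) : ℂ :=
  Complex.exp (-(ξ * conj ξ) / 2 + a * conj ξ + -conj b * ξ)

theorem integrable_displacementKernel_smul (a b : ℂ) (u : Fock) :
    Integrable fun ξ => displacementKernel a b ξ • displacement ξ u := by
  have hk : Integrable (displacementKernel a b) := integrable_cexp_gaussian a (-conj b)
  refine (hk.norm.mul_const ‖u‖).mono'
    (hk.aestronglyMeasurable.smul (continuous_displacement_apply u).aestronglyMeasurable)
    (Filter.Eventually.of_forall fun ξ => ?_)
  rw [norm_smul]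
  gcongr
  exact norm_displacement_le ξ u

/-- `∫ e^{-|ξ|²/2 + a ξ* - b* ξ} D(ξ) d²ξ = π e^{|a|²/2 + |b|²/2 - a b*} |a⟩⟨b|`. -/
theorem integral_displacementKernel_smul (a b : ℂ) (u : Fock) :
    ∫ ξ, displacementKernel a b ξ • displacement ξ u =
      (Real.pi * Complex.exp ((‖a‖ : ℂ) ^ 2 / 2 + (‖b‖ : ℂ) ^ 2 / 2 - a * conj b)) •
        ⟪coherent b, u⟫_ℂ • coherent a := by
  set c : ℂ := Real.pi * Complex.exp ((‖a‖ : ℂ) ^ 2 / 2 + (‖b‖ : ℂ) ^ 2 / 2 - a * conj b) with hc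
  have hint := integrable_displacementKernel_smul a b
  have hk : Integrable (displacementKernel a b) := integrable_cexp_gaussian a (-conj b)
  let A : Op := LinearMap.mkContinuous
    { toFun := fun u => ∫ ξ, displacementKernel a b ξ • displacement ξ u
      map_add' := fun u v => by
        simp only [map_add, smul_add]
        exact integral_add (hint u) (hint v)
      map_smul' := fun c u => by
        simp only [map_smul, RingHom.id_apply]
        rw [← integral_smul]
        simp only [smul_comm c] }
    (∫ ξ, ‖displacementKernel a b ξ‖) fun u => by
      rw [← integral_mul_const]
      refine norm_integral_le_of_norm_le (hk.norm.mul_const ‖u‖)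
        (Filter.Eventually.of_forall fun ξ => ?_)
      rw [norm_smul]
      gcongr
      exact norm_displacement_le ξ u
  -- Both sides are bounded, so Gaussian integrals of coherent-state matrix elements suffice.
  have hA : A = c • InnerProductSpace.rankOne ℂ (coherent a) (coherent b) := by
    refine Op.ext_coherent fun γ => Fock.ext_inner_coherent fun α => ?_
    have h1 : ⟪coherent α, A (coherent γ)⟫_ℂ =
        ∫ ξ, ⟪coherent α, displacementKernel a b ξ • displacement ξ (coherent γ)⟫_ℂ :=
      (integral_inner (hint (coherent γ)) (coherent α)).symm
    have h2 : ∀ ξ, ⟪coherent α, displacementKernel a b ξ • displacement ξ (coherent γ)⟫_ℂ =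
        ⟪coherent α, coherent γ⟫_ℂ *
          Complex.exp (-(ξ * conj ξ) + (a - γ) * conj ξ + (conj α - conj b) * ξ) := fun ξ => by
      rw [inner_smul_right, inner_coherent_displacement, displacementKernel, mul_left_comm,
        ← Complex.exp_add]
      congr 2
      ring
    rw [h1]
    simp only [h2]
    rw [integral_const_mul, integral_cexp_gaussian, smul_apply,
      InnerProductSpace.rankOne_apply, inner_smul_right, inner_smul_right, hc,
      inner_coherent, inner_coherent, inner_coherent, mul_left_comm, mul_assoc,
      ← Complex.exp_add, ← Complex.exp_add, ← Complex.exp_add]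
    congr 2
    simp only [← Complex.conj_mul']
    ring
  change A u = _
  rw [hA, smul_apply, InnerProductSpace.rankOne_apply]

/-- A trace-class operator is determined by its characteristic function, since its coherent-state
matrix elements `⟨b|T|a⟩` are Gaussian averages of that function. -/
theorem eq_zero_of_charW_eq_zero {T : TraceClass} (hT : ∀ ξ, charW T ξ = 0) : T = 0 := by
  obtain ⟨ι, _, u, v, h⟩ := TraceClass.exists_nuclearExpansion T
  refine Subtype.ext (Op.ext_coherent fun a => Fock.ext_inner_coherent fun b => ?_)
  have hk : Integrable (displacementKernel a b) := integrable_cexp_gaussian a (-conj b)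
  have hb : ∀ i ξ, ‖displacementKernel a b ξ * ⟪v i, displacement ξ (u i)⟫_ℂ‖ ≤
      ‖displacementKernel a b ξ‖ * (‖v i‖ * ‖u i‖) := fun i ξ => by
    rw [norm_mul]
    gcongr
    refine (norm_inner_le_norm _ _).trans ?_
    gcongr
    exact norm_displacement_le ξ _
  have hint : ∀ i, Integrable fun ξ => displacementKernel a b ξ * ⟪v i, displacement ξ (u i)⟫_ℂ :=
    fun i => by
      simpa only [inner_smul_right] using
        (integrable_displacementKernel_smul a b (u i)).const_inner (𝕜 := ℂ) (v i)
  have hsum := hasSum_integral_of_summable_integral_norm hint (by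
    refine Summable.of_nonneg_of_le (fun i => integral_nonneg fun _ => norm_nonneg _)
      (fun i => ?_) ((summable_mul_of_summable_sq h.summable_right h.summable_left
        (fun _ => norm_nonneg _) (fun _ => norm_nonneg _)).mul_left
          (∫ ξ, ‖displacementKernel a b ξ‖))
    rw [← integral_mul_const]
    exact integral_mono (hint i).norm (hk.norm.mul_const _) (hb i))
  have hzero : ∀ ξ, ∑' i, displacementKernel a b ξ * ⟪v i, displacement ξ (u i)⟫_ℂ = 0 :=
    fun ξ => by rw [tsum_mul_left, (charW_hasSum h ξ).tsum_eq, hT, mul_zero]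
  simp only [hzero, integral_zero] at hsum
  set c : ℂ := Real.pi * Complex.exp ((‖a‖ : ℂ) ^ 2 / 2 + (‖b‖ : ℂ) ^ 2 / 2 - a * conj b) with hc
  have hc0 : c ≠ 0 := mul_ne_zero (by exact_mod_cast Real.pi_ne_zero) (Complex.exp_ne_zero _)
  have hterm : ∀ i, ∫ ξ, displacementKernel a b ξ * ⟪v i, displacement ξ (u i)⟫_ℂ =
      c * (⟪v i, coherent a⟫_ℂ * ⟪coherent b, u i⟫_ℂ) := fun i => by
    have h1 := integral_inner (𝕜 := ℂ) (integrable_displacementKernel_smul a b (u i)) (v i)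
    simp only [inner_smul_right] at h1
    rw [h1, integral_displacementKernel_smul, inner_smul_right, inner_smul_right]
    ring
  simp only [hterm] at hsum
  have h2 : HasSum (fun i => ⟪v i, coherent a⟫_ℂ * ⟪coherent b, u i⟫_ℂ)
      ⟪coherent b, (T : Op) (coherent a)⟫_ℂ := by
    simpa only [innerSL_apply_apply, inner_smul_right] using
      (h.hasSum (coherent a)).mapL (innerSL ℂ (coherent b))
  have h3 := (h2.mul_left c).unique hsum
  simpa [hc0] using h3

/-! ### The diagonal weight determines the operator -/

open scoped FourierTransform in
theorem sympFourier_eq_fourier (ψ : ℂ → ℂ) (ξ : ℂ) :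
    sympFourier ψ ξ = 𝓕 ψ (-Complex.I * ξ / Real.pi) := by
  rw [Real.fourier_eq', sympFourier]
  refine integral_congr_ae (Filter.Eventually.of_forall fun α => ?_)
  simp only [smul_eq_mul]
  rw [mul_comm]
  congr 2
  have hπ : (Real.pi : ℝ) ≠ 0 := Real.pi_ne_zero
  apply Complex.ext
  · simp [Complex.inner]
  · simp [Complex.inner]
    field_simp
    ring

open scoped FourierTransform in
/-- Every smooth compactly supported function is the Fourier transform of a test function. -/
theorem exists_phaseTest_sympFourier_eq {g : ℂ → ℂ} (hg : ContDiff ℝ (⊤ : ℕ∞) g)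
    (hc : HasCompactSupport g) : ∃ ψ : PhaseTest, sympFourier ψ.1 = g := by
  have hI : Complex.I * Real.pi ≠ 0 :=
    mul_ne_zero Complex.I_ne_zero (by exact_mod_cast Real.pi_ne_zero)
  -- `sympFourier` is the standard Fourier transform at the rotated frequency `-iξ/π`.
  set h : ℂ → ℂ := fun w => g (Complex.I * Real.pi * w)
  have hh : ContDiff ℝ (⊤ : ℕ∞) h := hg.comp (contDiff_const.mul contDiff_id)
  have hhc : HasCompactSupport h := hc.comp_homeomorph (Homeomorph.mulLeft₀ _ hI)
  let ψ : 𝓢(ℂ, ℂ) := 𝓕⁻ (hhc.toSchwartzMap hh)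
  have he : sympFourier ψ = g := by
    funext ξ
    rw [sympFourier_eq_fourier, ← SchwartzMap.fourier_coe, FourierTransform.fourier_fourierInv_eq]
    simp only [HasCompactSupport.toSchwartzMap_toFun, h]
    congr 1
    field_simp
    linear_combination -ξ * Complex.I_sq
  exact ⟨⟨ψ, by rw [he]; exact hc⟩, he⟩

/-- Continuous functions are separated by their pairings with the Fourier transforms of test
functions. -/
theorem eq_of_forall_integral_mul_sympFourier_eq {f g : ℂ → ℂ} (hf : Continuous f) (hg : Continuous g)
    (h : ∀ ψ : PhaseTest, ∫ ξ, f ξ * sympFourier ψ.1 ξ = ∫ ξ, g ξ * sympFourier ψ.1 ξ) :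
    f = g := by
  have hae : ∀ᵐ ξ, (f - g) ξ = 0 := by
    refine ae_eq_zero_of_integral_contDiff_smul_eq_zero
      (hf.sub hg).locallyIntegrable fun k hk hkc => ?_
    have hkc' : HasCompactSupport fun ξ => (k ξ : ℂ) := hkc.comp_left Complex.ofReal_zero
    have hk' : Continuous fun ξ => (k ξ : ℂ) := Complex.continuous_ofReal.comp hk.continuous
    obtain ⟨ψ, hψ⟩ := exists_phaseTest_sympFourier_eq (g := fun ξ => (k ξ : ℂ))
      (Complex.ofRealCLM.contDiff.comp hk) hkc'
    have h1 := h ψ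
    rw [hψ] at h1
    have hint : ∀ {F : ℂ → ℂ}, Continuous F → Integrable fun ξ => F ξ * (k ξ : ℂ) := fun hF =>
      (hF.mul hk').integrable_of_hasCompactSupport hkc'.mul_left
    have h2 := integral_sub (hint hf) (hint hg)
    rw [h1, sub_self] at h2
    rw [← h2]
    refine integral_congr_ae (Filter.Eventually.of_forall fun ξ => ?_)
    simp only [Pi.sub_apply, Complex.real_smul]
    ring
  exact Continuous.ae_eq_iff_eq volume hf hg |>.1 (hae.mono fun ξ hξ => sub_eq_zero.1 hξ)

theorem charN_injective {S T : TraceClass} (h : charN S = charN T) : S = T := by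
  have h0 : ∀ ξ, charW (S + (-1 : ℂ) • T) ξ = 0 := fun ξ => ?_
  · have h1 := eq_zero_of_charW_eq_zero h0
    rwa [show (-1 : ℂ) • T = -T from neg_one_smul ℂ T, ← sub_eq_add_neg, sub_eq_zero] at h1
  have h1 : charW S ξ = charW T ξ := by
    have h2 := congrFun h ξ
    exact mul_right_cancel₀ (by exact_mod_cast (Real.exp_pos _).ne') h2
  obtain ⟨_, _, u, v, hS⟩ := TraceClass.exists_nuclearExpansion S
  obtain ⟨_, _, u', v', hT⟩ := TraceClass.exists_nuclearExpansion T
  have h2 := charW_hasSum (T := S + (-1 : ℂ) • T) (hS.add (hT.smul (-1))) ξ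
  have h3 : HasSum (fun i => ⟪v' i, displacement ξ ((-1 : ℂ) • u' i)⟫_ℂ) (-1 * charW T ξ) := by
    simpa only [map_smul, inner_smul_right] using (charW_hasSum hT ξ).mul_left (-1)
  have h4 := HasSum.sum (f := fun i => ⟪Sum.elim v v' i,
    displacement ξ (Sum.elim u (fun i => (-1 : ℂ) • u' i) i)⟫_ℂ) (charW_hasSum hS ξ) h3
  rw [h2.unique h4, h1]
  ring

/-- In Fourier space, the scaling of the diagonal weight is `χ_N(ξ) ↦ χ_N(κξ)`. -/
theorem scaleWeight_diagonalWeight (κ : ℝ) (hκ : κ ≠ 0) (T : TraceClass) (ψ : PhaseTest) :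
    scaleWeight κ hκ (diagonalWeight T) ψ =
      (Real.pi : ℂ)⁻¹ * ∫ ξ : ℂ, charN T (κ * ξ) * sympFourier ψ.1 ξ := by
  have h := Measure.integral_comp_smul (volume : Measure ℂ)
    (fun ξ => charN T (κ * ξ) * sympFourier ψ.1 ξ) κ⁻¹
  rw [Complex.finrank_real_complex, abs_of_nonneg (by positivity)] at h
  have hκ' : (κ : ℂ) ≠ 0 := by exact_mod_cast hκ
  have h2 : (∫ ξ : ℂ, charN T (κ * ξ) * sympFourier ψ.1 ξ) =
      ((κ ^ 2)⁻¹ : ℝ) • ∫ ξ : ℂ, charN T ξ * sympFourier ψ.1 (κ⁻¹ • ξ) := by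
    have h3 : ∀ ξ : ℂ, (κ : ℂ) * (κ⁻¹ • ξ) = ξ := fun ξ => by
      rw [Complex.real_smul, Complex.ofReal_inv, mul_inv_cancel_left₀ hκ']
    simp only [h3] at h
    rw [h, smul_smul, inv_pow, inv_inv, inv_mul_cancel₀ (pow_ne_zero 2 hκ), one_smul]
  rw [h2, scaleWeight, diagonalWeight, ← integral_smul]
  congr 2
  funext ξ
  change charN T ξ * sympFourier (dilateSchwartz κ hκ ψ.1) ξ = _
  rw [sympFourier_dilate, mul_smul_comm]

theorem diagonalWeight_eq_scaleWeight_iff (κ : ℝ) (hκ : κ ≠ 0) (S T : TraceClass) :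
    diagonalWeight S = scaleWeight κ hκ (diagonalWeight T) ↔
      charN S = fun ξ => charN T (κ * ξ) := by
  constructor
  · intro h
    refine eq_of_forall_integral_mul_sympFourier_eq (continuous_charN S)
      ((continuous_charN T).comp (continuous_const.mul continuous_id)) fun ψ => ?_
    have h1 := congrFun h ψ
    rw [scaleWeight_diagonalWeight, diagonalWeight] at h1
    exact mul_left_cancel₀ (inv_ne_zero (by exact_mod_cast Real.pi_ne_zero)) h1
  · intro h
    funext ψ
    rw [scaleWeight_diagonalWeight, diagonalWeight, h]

/-! ### The attenuation map -/

theorem summable_krausB_prod {κ : ℝ} (hκ : 0 < κ ∧ κ < 1) {ι : Type} {u : ι → Fock}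
    (hu : Summable fun i => ‖u i‖ ^ 2) :
    Summable fun p : ι × ℕ => ‖krausB κ hκ p.2 (u p.1)‖ ^ 2 := by
  refine (summable_prod_of_nonneg fun _ => sq_nonneg _).2
    ⟨fun i => (krausB_hasSum_norm_sq hκ (u i)).summable, ?_⟩
  exact hu.congr fun i => (krausB_hasSum_norm_sq hκ (u i)).tsum_eq.symm

theorem IsNuclearExpansion.krausB_conj_hasSum {κ : ℝ} (hκ : 0 < κ ∧ κ < 1) {ι : Type}
    {u v : ι → Fock} {T : Op} (h : IsNuclearExpansion u v T) (ℓ : ℕ) (x : Fock) :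
    HasSum (fun i => ⟪krausB κ hκ ℓ (v i), x⟫_ℂ • krausB κ hκ ℓ (u i))
      ((krausB κ hκ ℓ ∘L T ∘L (krausB κ hκ ℓ).adjoint) x) := by
  have h1 := (h.hasSum ((krausB κ hκ ℓ).adjoint x)).mapL (krausB κ hκ ℓ)
  simp only [map_smul, ContinuousLinearMap.adjoint_inner_right] at h1
  exact h1

/-- With `T = ∑ᵢ |uᵢ⟩⟨vᵢ|`, the norm of `B_ℓ T B_ℓ†` is at most `∑ᵢ ‖B_ℓ vᵢ‖ ‖B_ℓ uᵢ‖`, which is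
summable over `ℓ` by completeness of the Kraus operators. -/
theorem IsNuclearExpansion.summable_krausB_conj {κ : ℝ} (hκ : 0 < κ ∧ κ < 1) {ι : Type}
    {u v : ι → Fock} {T : Op} (h : IsNuclearExpansion u v T) :
    Summable fun ℓ => krausB κ hκ ℓ ∘L T ∘L (krausB κ hκ ℓ).adjoint := by
  have hs : Summable fun p : ℕ × ι => ‖krausB κ hκ p.1 (v p.2)‖ * ‖krausB κ hκ p.1 (u p.2)‖ :=
    (Equiv.prodComm ℕ ι).summable_iff.2 (summable_mul_of_summable_sq
      (summable_krausB_prod hκ h.summable_right) (summable_krausB_prod hκ h.summable_left)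
      (fun _ => norm_nonneg _) fun _ => norm_nonneg _)
  refine Summable.of_norm_bounded hs.prod fun ℓ => ?_
  refine ContinuousLinearMap.opNorm_le_bound _ (tsum_nonneg fun _ => by positivity) fun x => ?_
  rw [← tsum_mul_right]
  refine (h.krausB_conj_hasSum hκ ℓ x).norm_le_of_bounded
    ((hs.prod_factor ℓ).mul_right ‖x‖).hasSum fun i => ?_
  rw [norm_smul, mul_right_comm]
  gcongr
  exact norm_inner_le_norm _ _

/-- The Kraus maps act on expansions termwise. -/
theorem IsNuclearExpansion.tsum_krausB_conj {κ : ℝ} (hκ : 0 < κ ∧ κ < 1) {ι : Type}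
    {u v : ι → Fock} {T : Op} (h : IsNuclearExpansion u v T) :
    IsNuclearExpansion (fun p : ι × ℕ => krausB κ hκ p.2 (u p.1))
      (fun p : ι × ℕ => krausB κ hκ p.2 (v p.1))
      (∑' ℓ, krausB κ hκ ℓ ∘L T ∘L (krausB κ hκ ℓ).adjoint) where
  summable_left := summable_krausB_prod hκ h.summable_left
  summable_right := summable_krausB_prod hκ h.summable_right
  hasSum x := by
    have hs : Summable fun p : ι × ℕ =>
        ⟪krausB κ hκ p.2 (v p.1), x⟫_ℂ • krausB κ hκ p.2 (u p.1) := by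
      refine Summable.of_norm_bounded ((summable_mul_of_summable_sq
        (summable_krausB_prod hκ h.summable_right) (summable_krausB_prod hκ h.summable_left)
        (fun _ => norm_nonneg _) fun _ => norm_nonneg _).mul_right ‖x‖) fun p => ?_
      rw [norm_smul, mul_right_comm]
      gcongr
      exact norm_inner_le_norm _ _
    have h1 := ((Equiv.prodComm ℕ ι).hasSum_iff.2 hs.hasSum).prod_fiberwise
      fun ℓ => h.krausB_conj_hasSum hκ ℓ x
    have h2 := (h.summable_krausB_conj hκ).hasSum.mapL (ContinuousLinearMap.apply ℂ Fock x)
    rw [show (∑' ℓ, krausB κ hκ ℓ ∘L T ∘L (krausB κ hκ ℓ).adjoint) x = _ from h2.unique h1]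
    exact hs.hasSum

theorem summable_krausB_conj {κ : ℝ} (hκ : 0 < κ ∧ κ < 1) (T : TraceClass) :
    Summable fun ℓ => krausB κ hκ ℓ ∘L (T : Op) ∘L (krausB κ hκ ℓ).adjoint := by
  obtain ⟨_, _, _, _, h⟩ := TraceClass.exists_nuclearExpansion T
  exact h.summable_krausB_conj hκ

theorem hasSum_inner_krausB_conj {κ : ℝ} (hκ : 0 < κ ∧ κ < 1) {T : Op}
    (hs : Summable fun ℓ => krausB κ hκ ℓ ∘L T ∘L (krausB κ hκ ℓ).adjoint) (x y : Fock) :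
    HasSum (fun ℓ => ⟪(krausB κ hκ ℓ).adjoint x, T ((krausB κ hκ ℓ).adjoint y)⟫_ℂ)
      ⟪x, (∑' ℓ, krausB κ hκ ℓ ∘L T ∘L (krausB κ hκ ℓ).adjoint) y⟫_ℂ := by
  have h1 := (hs.hasSum.mapL (ContinuousLinearMap.apply ℂ Fock y)).mapL (innerSL ℂ x)
  simp only [ContinuousLinearMap.adjoint_inner_left]
  exact h1

theorem isPositive_of_inner_nonneg {A : Op} (h : ∀ x, 0 ≤ ⟪x, A x⟫_ℂ) : A.IsPositive := by
  refine (ContinuousLinearMap.isPositive_iff_complex A).2 fun x => ?_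
  have h1 := h x
  rw [← inner_conj_symm] at h1
  have h2 : 0 ≤ ⟪A x, x⟫_ℂ := by
    rw [← Complex.conj_conj ⟪A x, x⟫_ℂ, Complex.conj_eq_iff_im.2 (Complex.nonneg_iff.1 h1).2.symm]
    exact h1
  obtain ⟨h3, h4⟩ := Complex.nonneg_iff.1 h2
  exact ⟨Complex.ext rfl h4, h3⟩

theorem isPositive_tsum_krausB_conj {κ : ℝ} (hκ : 0 < κ ∧ κ < 1) {T : Op} (hT : T.IsPositive)
    (hs : Summable fun ℓ => krausB κ hκ ℓ ∘L T ∘L (krausB κ hκ ℓ).adjoint) :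
    (∑' ℓ, krausB κ hκ ℓ ∘L T ∘L (krausB κ hκ ℓ).adjoint).IsPositive :=
  isPositive_of_inner_nonneg fun x =>
    (hasSum_inner_krausB_conj hκ hs x x).nonneg fun _ => hT.inner_nonneg_right _

/-- The image is trace class: by linearity it suffices to treat positive operators, whose images
are positive with a nuclear expansion. -/
theorem tsum_krausB_conj_mem {κ : ℝ} (hκ : 0 < κ ∧ κ < 1) (T : TraceClass) :
    ∑' ℓ, krausB κ hκ ℓ ∘L (T : Op) ∘L (krausB κ hκ ℓ).adjoint ∈ TraceClass := by
  obtain ⟨T, hT⟩ := T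
  induction hT using Submodule.span_induction with
  | mem A hA =>
    obtain ⟨u, hu⟩ := exists_nuclearExpansion_of_isPositive hA.1 hA.2
    exact Submodule.subset_span ⟨isPositive_tsum_krausB_conj hκ hA.1 (hu.summable_krausB_conj hκ),
      (hu.tsum_krausB_conj hκ).trace.1⟩
  | zero => simp
  | add S T hS' hT' hS hT =>
    have h := (summable_krausB_conj hκ ⟨S, hS'⟩).tsum_add (summable_krausB_conj hκ ⟨T, hT'⟩)
    simp only [ContinuousLinearMap.add_comp, ContinuousLinearMap.comp_add]
    rw [h]
    exact add_mem hS hT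
  | smul c T hT' hT =>
    have h := (summable_krausB_conj hκ ⟨T, hT'⟩).tsum_const_smul c
    simp only [ContinuousLinearMap.smul_comp, ContinuousLinearMap.comp_smul]
    rw [h]
    exact TraceClass.smul_mem c hT

/-- The quantum-limited attenuator on the trace class, defined by its Kraus decomposition. -/
noncomputable def attenuate (κ : ℝ) (hκ : 0 < κ ∧ κ < 1) : TraceClass →ₗ[ℂ] TraceClass where
  toFun T := ⟨∑' ℓ, krausB κ hκ ℓ ∘L (T : Op) ∘L (krausB κ hκ ℓ).adjoint,
    tsum_krausB_conj_mem hκ T⟩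
  map_add' S T := Subtype.ext <| by
    have h := (summable_krausB_conj hκ S).tsum_add (summable_krausB_conj hκ T)
    simp only [Submodule.coe_add, ContinuousLinearMap.add_comp, ContinuousLinearMap.comp_add]
    exact h
  map_smul' c T := Subtype.ext <| by
    have h := (summable_krausB_conj hκ T).tsum_const_smul c
    simp only [Submodule.coe_smul, ContinuousLinearMap.smul_comp, ContinuousLinearMap.comp_smul,
      RingHom.id_apply]
    exact h

theorem attenuate_isKrausDecomposition {κ : ℝ} (hκ : 0 < κ ∧ κ < 1) :
    IsKrausDecomposition (krausB κ hκ) (attenuate κ hκ) :=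
  ⟨krausB_hasSum_adjoint_apply hκ, fun T => (summable_krausB_conj hκ T).hasSum⟩

theorem hasSum_inner_attenuate {κ : ℝ} (hκ : 0 < κ ∧ κ < 1) (T : TraceClass) (x y : Fock) :
    HasSum (fun ℓ => ⟪(krausB κ hκ ℓ).adjoint x, (T : Op) ((krausB κ hκ ℓ).adjoint y)⟫_ℂ)
      ⟪x, (attenuate κ hκ T : Op) y⟫_ℂ :=
  hasSum_inner_krausB_conj hκ (summable_krausB_conj hκ T) x y

theorem IsNuclearExpansion.attenuate {κ : ℝ} (hκ : 0 < κ ∧ κ < 1) {ι : Type} {u v : ι → Fock}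
    {T : TraceClass} (h : IsNuclearExpansion u v (T : Op)) :
    IsNuclearExpansion (fun p : ι × ℕ => krausB κ hκ p.2 (u p.1))
      (fun p : ι × ℕ => krausB κ hκ p.2 (v p.1)) (attenuate κ hκ T : Op) :=
  h.tsum_krausB_conj hκ

/-- Matrix elements of `Φ(T)` are sums over `ℓ` of the block forms of `T` at `B_ℓ† x`. -/
theorem attenuate_isCP {κ : ℝ} (hκ : 0 < κ ∧ κ < 1) : IsCP (attenuate κ hκ) := fun k T hT x => by
  have h := hasSum_sum (s := Finset.univ) fun i _ => hasSum_sum (s := Finset.univ) fun j _ =>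
    hasSum_inner_attenuate hκ (T i j) (x i) (x j)
  exact h.nonneg fun ℓ => hT fun i => (krausB κ hκ ℓ).adjoint (x i)

/-- Termwise, `∑_ℓ ⟨B_ℓ v, B_ℓ u⟩ = ⟨v, u⟩`. -/
theorem attenuate_isTP {κ : ℝ} (hκ : 0 < κ ∧ κ < 1) : IsTP (attenuate κ hκ) := fun T => by
  obtain ⟨_, _, u, v, h⟩ := TraceClass.exists_nuclearExpansion T
  exact ((h.attenuate hκ).trace.2.prod_fiberwise
    fun i => krausB_hasSum_inner hκ (u i) (v i)).unique h.trace.2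

theorem attenuate_isState {κ : ℝ} (hκ : 0 < κ ∧ κ < 1) {ρ : TraceClass} (hρ : IsState ρ) :
    IsState (attenuate κ hκ ρ) :=
  ⟨isPositive_tsum_krausB_conj hκ hρ.1 (summable_krausB_conj hκ ρ),
    (attenuate_isTP hκ ρ).trans hρ.2⟩

/-- The Kraus branch `ℓ` of `|α⟩⟨α|` is `|κα⟩⟨κα|`, weighted with the Poisson probability of losing
`ℓ` quanta. -/
theorem inner_krausB_adjoint_coherent {κ : ℝ} (hκ : 0 < κ ∧ κ < 1) (ℓ : ℕ) (α : ℂ) (x y : Fock) :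
    ⟪coherent α, (krausB κ hκ ℓ).adjoint y⟫_ℂ * ⟪(krausB κ hκ ℓ).adjoint x, coherent α⟫_ℂ =
      ((‖coherentCoeff ((Real.sqrt (1 - κ ^ 2) : ℝ) * α) ℓ‖ ^ 2 : ℝ) : ℂ) *
        (⟪x, coherent (κ * α)⟫_ℂ * ⟪coherent (κ * α), y⟫_ℂ) := by
  rw [ContinuousLinearMap.adjoint_inner_right, ContinuousLinearMap.adjoint_inner_left,
    krausB_coherent, inner_smul_left, inner_smul_right, Complex.ofReal_pow, ← Complex.conj_mul']
  ring

theorem attenuate_coherentProj {κ : ℝ} (hκ : 0 < κ ∧ κ < 1) (α : ℂ) :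
    attenuate κ hκ (coherentProj α) = coherentProj ((κ : ℂ) * α) := by
  refine Subtype.ext (ContinuousLinearMap.ext fun y => ext_inner_left ℂ fun x => ?_)
  have h1 : ∀ ℓ, ⟪(krausB κ hκ ℓ).adjoint x, (coherentProj α : Op) ((krausB κ hκ ℓ).adjoint y)⟫_ℂ =
      ((‖coherentCoeff ((Real.sqrt (1 - κ ^ 2) : ℝ) * α) ℓ‖ ^ 2 : ℝ) : ℂ) *
        (⟪x, coherent (κ * α)⟫_ℂ * ⟪coherent (κ * α), y⟫_ℂ) := fun ℓ => by
    rw [coherentProj, InnerProductSpace.rankOne_apply, inner_smul_right]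
    exact inner_krausB_adjoint_coherent hκ ℓ α x y
  have h2 := hasSum_inner_attenuate hκ (coherentProj α) x y
  simp only [h1] at h2
  have h3 := (Complex.ofRealCLM.hasSum (hasSum_norm_sq_coherentCoeff
    ((Real.sqrt (1 - κ ^ 2) : ℝ) * α))).mul_right
      (⟪x, coherent (κ * α)⟫_ℂ * ⟪coherent (κ * α), y⟫_ℂ)
  rw [h2.unique h3, coherentProj, InnerProductSpace.rankOne_apply, inner_smul_right]
  simp [mul_comm]

/-! ### The action on characteristic functions -/

theorem summable_norm_krausB_mul_norm {κ : ℝ} (hκ : 0 < κ ∧ κ < 1) (u v : Fock) :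
    Summable fun ℓ => ‖krausB κ hκ ℓ v‖ * ‖krausB κ hκ ℓ u‖ :=
  summable_mul_of_summable_sq (krausB_hasSum_norm_sq hκ v).summable
    (krausB_hasSum_norm_sq hκ u).summable (fun _ => norm_nonneg _) fun _ => norm_nonneg _

theorem tsum_norm_krausB_mul_norm_le {κ : ℝ} (hκ : 0 < κ ∧ κ < 1) (u v : Fock) :
    ∑' ℓ, ‖krausB κ hκ ℓ v‖ * ‖krausB κ hκ ℓ u‖ ≤ ‖v‖ * ‖u‖ := by
  refine (summable_norm_krausB_mul_norm hκ u v).tsum_le_of_sum_le fun s => ?_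
  refine (Real.sum_mul_le_sqrt_mul_sqrt s _ _).trans ?_
  refine mul_le_mul ?_ ?_ (Real.sqrt_nonneg _) (norm_nonneg _)
  · exact Real.sqrt_le_left (norm_nonneg _) |>.2 (sum_le_hasSum s (fun _ _ => sq_nonneg _)
      (krausB_hasSum_norm_sq hκ v))
  · exact Real.sqrt_le_left (norm_nonneg _) |>.2 (sum_le_hasSum s (fun _ _ => sq_nonneg _)
      (krausB_hasSum_norm_sq hκ u))

theorem norm_inner_krausB_le {κ : ℝ} (hκ : 0 < κ ∧ κ < 1) (A : Op) (u v : Fock) (ℓ : ℕ) :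
    ‖⟪krausB κ hκ ℓ v, A (krausB κ hκ ℓ u)⟫_ℂ‖ ≤
      ‖A‖ * (‖krausB κ hκ ℓ v‖ * ‖krausB κ hκ ℓ u‖) := by
  refine (norm_inner_le_norm _ _).trans ?_
  rw [mul_left_comm]
  gcongr
  exact A.le_opNorm _

theorem summable_inner_krausB {κ : ℝ} (hκ : 0 < κ ∧ κ < 1) (A : Op) (u v : Fock) :
    Summable fun ℓ => ⟪krausB κ hκ ℓ v, A (krausB κ hκ ℓ u)⟫_ℂ :=
  Summable.of_norm_bounded ((summable_norm_krausB_mul_norm hκ u v).mul_left ‖A‖)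
    (norm_inner_krausB_le hκ A u v)

/-- The bounded sesquilinear form `(v, u) ↦ ∑_ℓ ⟨B_ℓ v, A B_ℓ u⟩` of the dual (Heisenberg
picture) map. -/
noncomputable def krausForm {κ : ℝ} (hκ : 0 < κ ∧ κ < 1) (A : Op) : Fock →L⋆[ℂ] Fock →L[ℂ] ℂ :=
  LinearMap.mkContinuous₂
    (LinearMap.mk₂'ₛₗ (starRingEnd ℂ) (RingHom.id ℂ)
      (fun v u => ∑' ℓ, ⟪krausB κ hκ ℓ v, A (krausB κ hκ ℓ u)⟫_ℂ)
      (fun v w u => by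
        simp only [map_add, inner_add_left]
        exact (summable_inner_krausB hκ A u v).tsum_add (summable_inner_krausB hκ A u w))
      (fun c v u => by
        simp only [map_smul, inner_smul_left, smul_eq_mul]
        exact tsum_mul_left)
      (fun v u w => by
        simp only [map_add, inner_add_right]
        exact (summable_inner_krausB hκ A u v).tsum_add (summable_inner_krausB hκ A w v))
      (fun c v u => by
        simp only [map_smul, inner_smul_right, smul_eq_mul, RingHom.id_apply]
        exact tsum_mul_left)) ‖A‖ fun v u => by
    refine (tsum_of_norm_bounded ((summable_norm_krausB_mul_norm hκ u v).mul_left ‖A‖).hasSum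
      (norm_inner_krausB_le hκ A u v)).trans ?_
    rw [tsum_mul_left, mul_assoc]
    gcongr
    exact tsum_norm_krausB_mul_norm_le hκ u v

theorem krausForm_apply {κ : ℝ} (hκ : 0 < κ ∧ κ < 1) (A : Op) (v u : Fock) :
    krausForm hκ A v u = ∑' ℓ, ⟪krausB κ hκ ℓ v, A (krausB κ hκ ℓ u)⟫_ℂ := rfl

/-- The dual map multiplies displacement operators by Gaussians,
`∑_ℓ B_ℓ† D(ξ) B_ℓ = e^{-(1-κ²)|ξ|²/2} D(κξ)`. It suffices to compare matrix elements between
coherent states, which the Kraus operators map to multiples of coherent states. -/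
theorem hasSum_inner_krausB_displacement {κ : ℝ} (hκ : 0 < κ ∧ κ < 1) (ξ : ℂ) (v u : Fock) :
    HasSum (fun ℓ => ⟪krausB κ hκ ℓ v, displacement ξ (krausB κ hκ ℓ u)⟫_ℂ)
      (⟪v, displacement ((κ : ℂ) * ξ) u⟫_ℂ *
        (Real.exp (-((1 - κ ^ 2) * ‖ξ‖ ^ 2 / 2)) : ℂ)) := by
  set c : ℂ := (Real.exp (-((1 - κ ^ 2) * ‖ξ‖ ^ 2 / 2)) : ℂ) with hc
  set s : ℂ := ((Real.sqrt (1 - κ ^ 2) : ℝ) : ℂ) with hs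
  have hs2 : s ^ 2 = 1 - (κ : ℂ) ^ 2 := by
    rw [hs]
    rw [← Complex.ofReal_pow, Real.sq_sqrt (one_sub_sq_nonneg hκ)]
    push_cast
    rfl
  have hcoh : ∀ α β, ∑' ℓ, ⟪krausB κ hκ ℓ (coherent α),
      displacement ξ (krausB κ hκ ℓ (coherent β))⟫_ℂ =
        ⟪coherent α, displacement ((κ : ℂ) * ξ) (coherent β)⟫_ℂ * c := by
    intro α β
    have h1 : ∀ ℓ, ⟪krausB κ hκ ℓ (coherent α), displacement ξ (krausB κ hκ ℓ (coherent β))⟫_ℂ =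
        ⟪(coherent (s * α) : ℕ → ℂ) ℓ, (coherent (s * β) : ℕ → ℂ) ℓ⟫_ℂ *
          ⟪coherent (κ * α), displacement ξ (coherent (κ * β))⟫_ℂ := fun ℓ => by
      rw [krausB_coherent, krausB_coherent, map_smul, inner_smul_left, inner_smul_right,
        coherent_apply, coherent_apply, RCLike.inner_apply]
      ring
    simp only [h1]
    rw [tsum_mul_right, ← lp.inner_eq_tsum, inner_coherent_displacement,
      inner_coherent_displacement, inner_coherent, inner_coherent, inner_coherent, hc,
      Complex.ofReal_exp, ← Complex.exp_add, ← Complex.exp_add, ← Complex.exp_add,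
      ← Complex.exp_add]
    congr 1
    push_cast
    simp only [← Complex.conj_mul', map_mul, Complex.conj_ofReal]
    have hsc : conj s = s := by rw [hs, Complex.conj_ofReal]
    rw [hsc]
    linear_combination (-(conj α * α) / 2 - conj β * β / 2 + conj α * β) * hs2
  have hform : krausForm hκ (displacement ξ) =
      ((innerSL ℂ : Fock →L⋆[ℂ] Fock →L[ℂ] ℂ).flip.comp
        (c • displacement ((κ : ℂ) * ξ))).flip := by
    refine ContinuousLinearMap.ext_on dense_span_coherent ?_
    rintro _ ⟨α, rfl⟩
    refine ContinuousLinearMap.ext_on dense_span_coherent ?_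
    rintro _ ⟨β, rfl⟩
    rw [krausForm_apply, hcoh]
    simp [mul_comm]
  have h := (summable_inner_krausB hκ (displacement ξ) u v).hasSum
  have h2 := congrArg (fun F : Fock →L⋆[ℂ] Fock →L[ℂ] ℂ => F v u) hform
  rw [← krausForm_apply, show krausForm hκ (displacement ξ) v u = _ from h2] at h
  simpa [inner_smul_right, mul_comm] using h

theorem attenuate_isAttenuator {κ : ℝ} (hκ : 0 < κ ∧ κ < 1) :
    IsAttenuator κ (attenuate κ hκ) := fun T ξ => by
  obtain ⟨_, _, u, v, h⟩ := TraceClass.exists_nuclearExpansion T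
  exact ((charW_hasSum (h.attenuate hκ) ξ).prod_fiberwise fun i =>
    hasSum_inner_krausB_displacement hκ ξ (v i) (u i)).unique
      ((charW_hasSum h ((κ : ℂ) * ξ)).mul_right _)

theorem charN_attenuate {κ : ℝ} (hκ : 0 < κ ∧ κ < 1) (T : TraceClass) :
    charN (attenuate κ hκ T) = fun ξ => charN T (κ * ξ) := by
  funext ξ
  rw [charN, charN, attenuate_isAttenuator hκ T ξ, mul_assoc, ← Complex.ofReal_mul,
    ← Real.exp_add, norm_mul, Complex.norm_real, Real.norm_eq_abs, mul_pow, sq_abs]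
  congr 3
  ring

theorem diagonalWeight_eq_scaleWeight_iff_eq_attenuate {κ : ℝ} (hκ : 0 < κ ∧ κ < 1)
    (T S : TraceClass) :
    diagonalWeight S = scaleWeight κ hκ.1.ne' (diagonalWeight T) ↔ S = attenuate κ hκ T := by
  rw [diagonalWeight_eq_scaleWeight_iff, ← charN_attenuate hκ]
  exact ⟨charN_injective, fun h => h ▸ rfl⟩

/-! ### Ordinary weight functions -/

/-- Termwise integration of an `L¹`-absolutely convergent series, including the integrability of
the sum. -/
theorem integrable_and_hasSum_integral_of_hasSum {F : ℕ → ℂ → ℂ} {H : ℂ → ℂ}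
    (hF : ∀ ℓ, Integrable (F ℓ)) (hs : Summable fun ℓ => ∫ α, ‖F ℓ α‖)
    (hH : ∀ α, HasSum (fun ℓ => F ℓ α) (H α)) :
    Integrable H ∧ HasSum (fun ℓ => ∫ α, F ℓ α) (∫ α, H α) := by
  have hm : AEStronglyMeasurable H volume :=
    aestronglyMeasurable_of_tendsto_ae Filter.atTop
      (f := fun n α => ∑ ℓ ∈ Finset.range n, F ℓ α)
      (fun n => Finset.aestronglyMeasurable_fun_sum _ fun ℓ _ => (hF ℓ).aestronglyMeasurable)
      (Filter.Eventually.of_forall fun α => (hH α).tendsto_sum_nat)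
  refine ⟨⟨hm, ?_⟩, ?_⟩
  · rw [hasFiniteIntegral_iff_enorm]
    calc ∫⁻ α, ‖H α‖ₑ ≤ ∫⁻ α, ∑' ℓ, ‖F ℓ α‖ₑ := lintegral_mono fun α => by
          rw [← (hH α).tsum_eq]
          exact enorm_tsum_le_tsum_enorm
      _ = ∑' ℓ, ∫⁻ α, ‖F ℓ α‖ₑ := lintegral_tsum fun ℓ => (hF ℓ).aestronglyMeasurable.enorm
      _ = ∑' ℓ, ENNReal.ofReal (∫ α, ‖F ℓ α‖) := by
          simp only [ofReal_integral_norm_eq_lintegral_enorm (hF _)]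
      _ < ⊤ := hs.tsum_ofReal_lt_top
  · have h := hasSum_integral_of_summable_integral_norm hF hs
    simpa only [(hH _).tsum_eq] using h

/-- The uniform boundedness principle for weight functions: if `|φ|` integrates every Husimi
function `|⟨α|u⟩|²`, then the integrals are bounded by a multiple of `‖u‖²`. This is the closed
graph theorem for the map `u ↦ √|φ(α)| ⟨α|u⟩` into `L²`. -/
theorem exists_integral_weight_le {φ : ℂ → ℂ} (hφ : AEStronglyMeasurable φ volume)
    (hint : ∀ u : Fock, Integrable fun α => ‖φ α‖ * ‖⟪coherent α, u⟫_ℂ‖ ^ 2) :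
    ∃ C, 0 ≤ C ∧ ∀ u : Fock, ∫ α, ‖φ α‖ * ‖⟪coherent α, u⟫_ℂ‖ ^ 2 ≤ C * ‖u‖ ^ 2 := by
  set g : ℂ → ℂ := fun α => ((Real.sqrt ‖φ α‖ : ℝ) : ℂ) with hg
  have hgm : AEStronglyMeasurable g volume :=
    (Complex.continuous_ofReal.comp Real.continuous_sqrt).comp_aestronglyMeasurable hφ.norm
  have hnorm : ∀ u α, ‖g α * ⟪coherent α, u⟫_ℂ‖ ^ 2 = ‖φ α‖ * ‖⟪coherent α, u⟫_ℂ‖ ^ 2 :=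
    fun u α => by
      rw [norm_mul, mul_pow, hg, Complex.norm_real, Real.norm_eq_abs, sq_abs,
        Real.sq_sqrt (norm_nonneg _)]
  have hmem : ∀ u : Fock, MemLp (fun α => g α * ⟪coherent α, u⟫_ℂ) 2 volume := fun u => by
    refine (memLp_two_iff_integrable_sq_norm (hgm.mul
      (continuous_coherent.inner continuous_const).aestronglyMeasurable)).2 ?_
    exact (hint u).congr (Filter.Eventually.of_forall fun α => (hnorm u α).symm)
  let L : Fock →ₗ[ℂ] Lp ℂ 2 (volume : Measure ℂ) :=
    { toFun := fun u => (hmem u).toLp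
      map_add' := fun u v => by
        rw [← MemLp.toLp_add]
        refine (MemLp.toLp_eq_toLp_iff _ _).2 (Filter.Eventually.of_forall fun α => ?_)
        simp [mul_add]
      map_smul' := fun c u => by
        rw [RingHom.id_apply, ← MemLp.toLp_const_smul]
        refine (MemLp.toLp_eq_toLp_iff _ _).2 (Filter.Eventually.of_forall fun α => ?_)
        simp [mul_left_comm] }
  have hL : Continuous L := by
    refine L.continuous_of_seq_closed_graph fun w x y hw hy => ?_
    obtain ⟨ns, hns, hae⟩ := (tendstoInMeasure_of_tendsto_Lp hy).exists_seq_tendsto_ae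
    refine Lp.ext ?_
    have h1 : ∀ᵐ α, ∀ n, (L (w n) : ℂ → ℂ) α = g α * ⟪coherent α, w n⟫_ℂ :=
      ae_all_iff.2 fun n => (hmem (w n)).coeFn_toLp
    filter_upwards [hae, h1, (hmem x).coeFn_toLp] with α h2 h3 h4
    refine tendsto_nhds_unique h2 ?_
    rw [show (L x : ℂ → ℂ) α = _ from h4]
    simp only [Function.comp_apply, h3]
    exact ((tendsto_const_nhds.inner hw).const_mul _).comp hns.tendsto_atTop
  refine ⟨‖(⟨L, hL⟩ : Fock →L[ℂ] Lp ℂ 2 (volume : Measure ℂ))‖ ^ 2, sq_nonneg _, fun u => ?_⟩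
  have h1 : ∫ α, ‖φ α‖ * ‖⟪coherent α, u⟫_ℂ‖ ^ 2 = ‖L u‖ ^ 2 := by
    have h2 : ((‖L u‖ ^ 2 : ℝ) : ℂ) = ∫ α, ((‖φ α‖ * ‖⟪coherent α, u⟫_ℂ‖ ^ 2 : ℝ) : ℂ) := by
      rw [Complex.ofReal_pow]
      refine (inner_self_eq_norm_sq_to_K (𝕜 := ℂ) (L u)).symm.trans ?_
      rw [L2.inner_def]
      refine integral_congr_ae ?_
      filter_upwards [(hmem u).coeFn_toLp] with α hα
      rw [show (L u : ℂ → ℂ) α = _ from hα, inner_self_eq_norm_sq_to_K, ← hnorm]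
      push_cast
      rfl
    rw [integral_complex_ofReal] at h2
    exact_mod_cast h2.symm
  rw [h1, ← mul_pow]
  gcongr
  exact (⟨L, hL⟩ : Fock →L[ℂ] Lp ℂ 2 (volume : Measure ℂ)).le_opNorm u

/-- Measurability of `φ` is implicit in the integrability of the vacuum matrix element, whose
density vanishes nowhere. -/
theorem HasWeightFunction.aestronglyMeasurable {T : TraceClass} {φ : ℂ → ℂ}
    (h : HasWeightFunction T φ) : AEStronglyMeasurable φ volume := by
  have h0 : Continuous fun α => (⟪coherent 0, coherent α⟫_ℂ * ⟪coherent α, coherent 0⟫_ℂ)⁻¹ := by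
    refine Continuous.inv₀ ((continuous_const.inner continuous_coherent).mul
      (continuous_coherent.inner continuous_const)) fun α => ?_
    rw [inner_coherent, inner_coherent]
    exact mul_ne_zero (Complex.exp_ne_zero _) (Complex.exp_ne_zero _)
  refine ((h (coherent 0) (coherent 0)).1.aestronglyMeasurable.mul h0.aestronglyMeasurable).congr
    (Filter.Eventually.of_forall fun α => ?_)
  refine mul_inv_cancel_right₀ ?_ _
  rw [inner_coherent, inner_coherent]
  exact mul_ne_zero (Complex.exp_ne_zero _) (Complex.exp_ne_zero _)

theorem HasWeightFunction.integrable_norm {T : TraceClass} {φ : ℂ → ℂ}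
    (h : HasWeightFunction T φ) (u : Fock) :
    Integrable fun α => ‖φ α‖ * ‖⟪coherent α, u⟫_ℂ‖ ^ 2 := by
  refine (h u u).1.norm.congr (Filter.Eventually.of_forall fun α => ?_)
  simp only [norm_mul]
  rw [norm_inner_symm u, sq]

/-- The integrals over all Kraus branches converge absolutely because
`∑_ℓ ‖B_ℓ† u‖² < ∞`, which makes the exchange of sum and integral legitimate. -/
theorem HasWeightFunction.integrable_and_inner_attenuate {κ : ℝ} (hκ : 0 < κ ∧ κ < 1)
    {T : TraceClass} {φ : ℂ → ℂ} (h : HasWeightFunction T φ) (x y : Fock) :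
    (Integrable fun α => φ α * (⟪x, coherent (κ * α)⟫_ℂ * ⟪coherent (κ * α), y⟫_ℂ)) ∧
      ⟪x, (attenuate κ hκ T : Op) y⟫_ℂ = (Real.pi : ℂ)⁻¹ *
        ∫ α, φ α * (⟪x, coherent (κ * α)⟫_ℂ * ⟪coherent (κ * α), y⟫_ℂ) := by
  obtain ⟨C, hC, hbound⟩ := exists_integral_weight_le h.aestronglyMeasurable h.integrable_norm
  set B := fun ℓ => (krausB κ hκ ℓ).adjoint
  have hF := fun ℓ => (h (B ℓ x) (B ℓ y)).1
  have hs : Summable fun ℓ =>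
      ∫ α, ‖φ α * (⟪B ℓ x, coherent α⟫_ℂ * ⟪coherent α, B ℓ y⟫_ℂ)‖ := by
    refine Summable.of_nonneg_of_le (fun _ => integral_nonneg fun _ => norm_nonneg _) (fun ℓ => ?_)
      (((krausB_summable_adjoint_norm_sq hκ x).add
        (krausB_summable_adjoint_norm_sq hκ y)).mul_left C)
    -- `|⟨B†x|α⟩⟨α|B†y⟩| ≤ |⟨α|B†x⟩|² + |⟨α|B†y⟩|²` reduces to the diagonal bound.
    have h1 := integral_mono (hF ℓ).norm ((h.integrable_norm (B ℓ x)).add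
      (h.integrable_norm (B ℓ y))) fun α => by
        simp only [norm_mul, Pi.add_apply]
        rw [norm_inner_symm (B ℓ x), ← mul_add]
        gcongr
        nlinarith [mul_le_half_add_sq ‖⟪coherent α, B ℓ x⟫_ℂ‖ ‖⟪coherent α, B ℓ y⟫_ℂ‖,
          sq_nonneg ‖⟪coherent α, B ℓ x⟫_ℂ‖, sq_nonneg ‖⟪coherent α, B ℓ y⟫_ℂ‖]
    refine h1.trans ?_
    rw [integral_add' (h.integrable_norm (B ℓ x)) (h.integrable_norm (B ℓ y)), mul_add]
    exact add_le_add (hbound _) (hbound _)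
  have hsum : ∀ α, HasSum (fun ℓ => φ α * (⟪B ℓ x, coherent α⟫_ℂ * ⟪coherent α, B ℓ y⟫_ℂ))
      (φ α * (⟪x, coherent (κ * α)⟫_ℂ * ⟪coherent (κ * α), y⟫_ℂ)) := fun α => by
    have h1 := (Complex.ofRealCLM.hasSum (hasSum_norm_sq_coherentCoeff
      ((Real.sqrt (1 - κ ^ 2) : ℝ) * α))).mul_right
        (⟪x, coherent (κ * α)⟫_ℂ * ⟪coherent (κ * α), y⟫_ℂ)
    rw [Complex.ofRealCLM_apply, Complex.ofReal_one, one_mul] at h1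
    refine (h1.mul_left (φ α)).congr_fun fun ℓ => ?_
    rw [mul_comm ⟪B ℓ x, coherent α⟫_ℂ, inner_krausB_adjoint_coherent hκ ℓ α x y]
    rfl
  obtain ⟨h1, h2⟩ := integrable_and_hasSum_integral_of_hasSum hF hs hsum
  refine ⟨h1, ?_⟩
  have h3 := hasSum_inner_attenuate hκ T x y
  exact h3.unique ((h2.mul_left _).congr_fun fun ℓ => (h (B ℓ x) (B ℓ y)).2)

theorem attenuate_hasWeightFunction {κ : ℝ} (hκ : 0 < κ ∧ κ < 1) {T : TraceClass} {φ : ℂ → ℂ}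
    (h : HasWeightFunction T φ) :
    HasWeightFunction (attenuate κ hκ T)
      fun α => ((κ ^ 2)⁻¹ : ℝ) * φ ((κ⁻¹ : ℝ) * α) := by
  intro u v
  obtain ⟨h1, h2⟩ := h.integrable_and_inner_attenuate hκ u v
  have hκ' : (κ : ℂ) ≠ 0 := by exact_mod_cast hκ.1.ne'
  set f : ℂ → ℂ := fun α =>
    φ ((κ⁻¹ : ℝ) * α) * (⟪u, coherent α⟫_ℂ * ⟪coherent α, v⟫_ℂ) with hf
  have hcomp : (fun α : ℂ => f (κ • α)) =
      fun α => φ α * (⟪u, coherent (κ * α)⟫_ℂ * ⟪coherent (κ * α), v⟫_ℂ) := by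
    funext α
    rw [hf]
    simp only [Complex.real_smul, Complex.ofReal_inv]
    rw [inv_mul_cancel_left₀ hκ']
  have hfac : (fun α : ℂ => ((κ ^ 2)⁻¹ : ℝ) * φ ((κ⁻¹ : ℝ) * α) *
      (⟪u, coherent α⟫_ℂ * ⟪coherent α, v⟫_ℂ)) = fun α => (((κ ^ 2)⁻¹ : ℝ) : ℂ) * f α := by
    funext α
    rw [hf, mul_assoc]
  have hint : Integrable f := by
    rw [← hcomp] at h1
    exact (integrable_comp_smul_iff volume f hκ.1.ne').1 h1
  beta_reduce
  rw [hfac]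
  refine ⟨hint.const_mul _, ?_⟩
  have h3 := Measure.integral_comp_smul (volume : Measure ℂ) f κ
  rw [Complex.finrank_real_complex, abs_of_nonneg (by positivity), hcomp] at h3
  rw [h2, h3, integral_const_mul, Complex.real_smul]

/-! ### Classicality -/

/-- Dilating the diagonal weight pushes a representing measure forward. -/
theorem IsClassical.of_dilate {S T : TraceClass} {c : ℝ} (hc : c ≠ 0)
    (h : ∀ ψ : PhaseTest, diagonalWeight S ψ = diagonalWeight T (ψ.dilate c hc))
    (hT : IsClassical T) : IsClassical S := by
  obtain ⟨μ, hμ, hμT⟩ := hT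
  refine ⟨μ.map fun α => (c : ℂ) * α, inferInstance, fun ψ => ?_⟩
  rw [h, hμT, integral_map (by fun_prop) ψ.1.continuous.aestronglyMeasurable]
  exact integral_congr_ae (Filter.Eventually.of_forall fun α => dilateSchwartz_apply c hc ψ.1 α)

theorem PhaseTest.dilate_dilate_inv {c : ℝ} (hc : c ≠ 0) (ψ : PhaseTest) :
    (ψ.dilate c⁻¹ (inv_ne_zero hc)).dilate c hc = ψ := by
  refine Subtype.ext (SchwartzMap.ext fun α => ?_)
  refine (dilateSchwartz_apply c hc _ α).trans ?_
  refine (dilateSchwartz_apply c⁻¹ (inv_ne_zero hc) ψ.1 _).trans ?_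
  rw [Complex.ofReal_inv, inv_mul_cancel_left₀ (by exact_mod_cast hc)]

theorem isClassical_attenuate_iff {κ : ℝ} (hκ : 0 < κ ∧ κ < 1) (ρ : TraceClass) :
    IsClassical (attenuate κ hκ ρ) ↔ IsClassical ρ := by
  have h : ∀ ψ, diagonalWeight (attenuate κ hκ ρ) ψ = diagonalWeight ρ (ψ.dilate κ hκ.1.ne') :=
    congrFun ((diagonalWeight_eq_scaleWeight_iff_eq_attenuate hκ ρ _).2 rfl)
  refine ⟨IsClassical.of_dilate (inv_ne_zero hκ.1.ne') fun ψ => ?_, IsClassical.of_dilate _ h⟩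
  rw [h, PhaseTest.dilate_dilate_inv]

theorem theorem6 (κ : ℝ) (hκ : 0 < κ ∧ κ < 1) :
    ∃ Φ : TraceClass →ₗ[ℂ] TraceClass,
      -- the scaling of the diagonal weight is a well-defined map on operators, namely `Φ`
      (∀ T S : TraceClass,
        diagonalWeight S = scaleWeight κ hκ.1.ne' (diagonalWeight T) ↔ S = Φ T) ∧
      -- it is a trace-preserving completely positive map with Kraus operators `B_ℓ(κ)`
      IsCP Φ ∧ IsTP Φ ∧ IsKrausDecomposition (krausB κ hκ) Φ ∧
      -- it is the quantum-limited attenuator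
      IsAttenuator κ Φ ∧
      -- every coherent state `|α⟩` is sent to `|κα⟩`
      (∀ α : ℂ, Φ (coherentProj α) = coherentProj ((κ : ℂ) * α)) ∧
      -- the scaling law when the diagonal weight is an ordinary function
      (∀ (T : TraceClass) (φ : ℂ → ℂ), HasWeightFunction T φ →
        HasWeightFunction (Φ T) fun α => ((κ ^ 2)⁻¹ : ℝ) * φ ((κ⁻¹ : ℝ) * α)) ∧
      -- nonclassicality is neither created nor destroyed
      (∀ ρ : TraceClass, IsState ρ → IsState (Φ ρ) ∧ (IsClassical (Φ ρ) ↔ IsClassical ρ)) :=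
  ⟨attenuate κ hκ, diagonalWeight_eq_scaleWeight_iff_eq_attenuate hκ, attenuate_isCP hκ,
    attenuate_isTP hκ, attenuate_isKrausDecomposition hκ, attenuate_isAttenuator hκ,
    attenuate_coherentProj hκ, fun _ _ h => attenuate_hasWeightFunction hκ h,
    fun ρ hρ => ⟨attenuate_isState hκ hρ, isClassical_attenuate_iff hκ ρ⟩⟩
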